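/- Let $0<s<1$, let $N\ge 1$ be an integer with $N>2s$, and let $\Omega\subset\mathbb{R}^N$ be a bounded domain (open, connected, nonempty) with smooth boundary. Let $$X_0^s(\Omega)=\{u\in H^s(\mathbb{R}^N):\ u=0\ \text{a.e. in}\ \mathbb{R}^N\setminus\Omega\},\qquad \|u\|_{X_0^s}^2=\int_{\mathbb{R}^N\times\mathbb{R}^N}\frac{|u(x)-u(y)|^2}{|x-y|^{N+2s}}\,dx\,dy .$$ Let $f:[0,\infty)\to\mathbb{R}$ be continuous with $f(0)=0$, put $F(t)=\int_0^t f(\tau)\,d\tau$, and assume $$-\infty<\liminf_{t\to0^+}\frac{F(t)}{t^2}\le\limsup_{t\to0^+}\frac{F(t)}{t^2}=+\infty,\qquad l_0:=\liminf_{t\to0^+}\frac{f(t)}{t}<0,$$ where $l_0=-\infty$ is allowed. Let $p,\lambda\in\mathbb{R}$ be such that either (a) $p=1$ and $\lambda<\lambda_0$ for some real $\lambda_0$ with $0<\lambda_0<-l_0$, or (b) $p>1$ (and $\lambda$ is arbitrary). Then there is a sequence $(u_k)_{k\in\mathbb{N}}$ of pairwise distinct (as elements of $X_0^s(\Omega)$)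 functions in $X_0^s(\Omega)\cap L^\infty(\Omega)$ such that every $u_k$ is a positive weak solution of $$(-\Delta)^s u=\lambda u^p+f(u)\ \text{ in }\Omega,\qquad u>0\ \text{ in }\Omega,\qquad u=0\ \text{ in }\mathbb{R}^N\setminus\Omega,$$ that is, $u_k>0$ a.e. in $\Omega$ and, for every $\varphi\in X_0^s(\Omega)$, the functions $u_k^p\varphi$ and $f(u_k)\varphi$ are integrable over $\Omega$ and $$\int_{\mathbb{R}^N\times\mathbb{R}^N}\frac{(u_k(x)-u_k(y))(\varphi(x)-\varphi(y))}{|x-y|^{N+2s}}\,dx\,dy=\lambda\int_\Omega u_k^p\varphi\,dx+\int_\Omega f(u_k)\varphi\,dx,$$ and such that $$\lim_{k\to\infty}\|u_k\|_{X_0^s}=\lim_{k\to\infty}\|u_k\|_{L^\infty(\Omega)}=0 .$$ -/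

import Mathlib

open MeasureTheory Filter Topology

noncomputable section

/-- A bounded domain (open, connected, nonempty) of `ℝ^N` with smooth boundary: near each boundary
point, the domain is the sublevel set of a smooth function with nonvanishing differential. -/
structure IsBoundedSmoothDomain {N : ℕ} (Ω : Set (EuclideanSpace ℝ (Fin N))) : Prop where
  isOpen : IsOpen Ω
  isConnected : IsConnected Ω
  isBounded : Bornology.IsBounded Ω
  smooth_boundary : ∀ x₀ ∈ frontier Ω, ∃ (U : Set (EuclideanSpace ℝ (Fin N)))
    (ρ : EuclideanSpace ℝ (Fin N) → ℝ), IsOpen U ∧ x₀ ∈ U ∧ ContDiffOn ℝ (⊤ : ℕ∞) ρ U ∧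
      fderiv ℝ ρ x₀ ≠ 0 ∧ Ω ∩ U = {x ∈ U | ρ x < 0}

/-- The integrand `(u(x)-u(y))(v(x)-v(y)) / |x-y|^(N+2s)` on `ℝ^N × ℝ^N`. -/
def gagliardoIntegrand {N : ℕ} (s : ℝ) (u v : EuclideanSpace ℝ (Fin N) → ℝ)
    (z : EuclideanSpace ℝ (Fin N) × EuclideanSpace ℝ (Fin N)) : ℝ :=
  (u z.1 - u z.2) * (v z.1 - v z.2) / ‖z.1 - z.2‖ ^ ((N : ℝ) + 2 * s)

/-- The scalar product `⟨u, v⟩` of `X_0^s`. -/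
def gagliardoForm {N : ℕ} (s : ℝ) (u v : EuclideanSpace ℝ (Fin N) → ℝ) : ℝ :=
  ∫ z, gagliardoIntegrand s u v z

/-- `u` belongs to the fractional Sobolev space `H^s(ℝ^N)`: it is square integrable and has finite
Gagliardo seminorm. -/
def MemHs {N : ℕ} (s : ℝ) (u : EuclideanSpace ℝ (Fin N) → ℝ) : Prop :=
  MemLp u 2 volume ∧ Integrable (gagliardoIntegrand s u u) volume

/-- `u` belongs to `X_0^s(Ω)`: it is in `H^s(ℝ^N)` and vanishes a.e. outside `Ω`. -/
def MemX0 {N : ℕ} (s : ℝ) (Ω : Set (EuclideanSpace ℝ (Fin N)))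
    (u : EuclideanSpace ℝ (Fin N) → ℝ) : Prop :=
  MemHs s u ∧ ∀ᵐ x, x ∉ Ω → u x = 0

/-- The norm of `X_0^s`. -/
def normX0 {N : ℕ} (s : ℝ) (u : EuclideanSpace ℝ (Fin N) → ℝ) : ℝ :=
  Real.sqrt (gagliardoForm s u u)

/-- `u` is a positive weak solution of `(-Δ)^s u = lam * u^p + f(u)`, `u > 0` in `Ω`, and `u = 0`
in `ℝ^N \ Ω`. The integrals on the right-hand side are required to converge absolutely. -/
structure IsPositiveWeakSolution {N : ℕ} (s : ℝ) (Ω : Set (EuclideanSpace ℝ (Fin N)))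
    (lam p : ℝ) (f : ℝ → ℝ) (u : EuclideanSpace ℝ (Fin N) → ℝ) : Prop where
  mem : MemX0 s Ω u
  pos : ∀ᵐ x, x ∈ Ω → 0 < u x
  integrable_pow : ∀ φ, MemX0 s Ω φ → IntegrableOn (fun x => u x ^ p * φ x) Ω
  integrable_f : ∀ φ, MemX0 s Ω φ → IntegrableOn (fun x => f (u x) * φ x) Ω
  weak_eq : ∀ φ, MemX0 s Ω φ →
    gagliardoForm s u φ = lam * (∫ x in Ω, u x ^ p * φ x) + ∫ x in Ω, f (u x) * φ x

/-- `l₀ = liminf_{t → 0⁺} f(t) / t`, as an extended real number. -/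
def lZero (f : ℝ → ℝ) : EReal :=
  liminf (fun t : ℝ => ((f t / t : ℝ) : EReal)) (𝓝[>] 0)

/-- The quotient `F(t) / t²` with `F(t) = ∫_0^t f`, as an extended real number. -/
def primitiveQuotient (f : ℝ → ℝ) (t : ℝ) : EReal :=
  (((∫ τ in (0 : ℝ)..t, f τ) / t ^ 2 : ℝ) : EReal)

/-- `f` oscillates near the origin:
`-∞ < liminf F(t)/t² ≤ limsup F(t)/t² = +∞` as `t → 0⁺`, and `l₀ < 0`. -/
structure OscillatesNearZero (f : ℝ → ℝ) : Prop where
  liminf_gt : ⊥ < liminf (primitiveQuotient f) (𝓝[>] 0)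
  limsup_eq : limsup (primitiveQuotient f) (𝓝[>] 0) = ⊤
  lZero_neg : lZero f < 0

end

/-! Put `g t = lam * t ^ p + f t`. The condition on `l₀` gives arbitrarily small `b > 0` with `g b <
0` (`frequently_mul_rpow_add_neg`). Freeze `g` outside `[0, b]`: the truncated nonlinearity vanishes
to the left of `0` and equals the negative constant `g b` to the right of `b`. Clamping a function
to `[0, b]` therefore increases the primitive term and decreases the Gagliardo term, so a minimizer
of the energy among functions with values in `[0, b]` is a global one (`exists_energy_minimizer`).
It satisfies the Euler–Lagrange equation, and on its range the truncation is invisible.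

The minimizer is nonzero: `limsup F(t)/t² = +∞`, together with the finite lower bound on `F(t)/t²`,
makes a small multiple of a cutoff function have negative energy (`exists_energy_neg`). It is then
positive by a strong maximum principle needing only that `g` is continuous with `g 0 = 0`
(`ae_pos_of_weak_solution`).

Compactness for the minimization is obtained directly for uniformly bounded functions: weak `L²`
convergence makes averages over small balls converge, and the Gagliardo energy controls the
deviation from these averages (`exists_subseq_tendsto_ae`).

Taking each bound `b` at most half of the previous sup norm yields distinct solutions tending to
zero uniformly; testing each equation with its own solution sends the energies to zero. -/

noncomputable section

/-! ### Gagliardo form and the space `X_0^s`: linear structure, contractions, lower semicontinuity.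
-/

section Gagliardo

variable {N : ℕ} {s : ℝ} {Ω : Set (EuclideanSpace ℝ (Fin N))}

/-- Fatou's lemma for nonnegative real functions whose integrals are controlled by a convergent
sequence. -/
theorem integrable_and_integral_le_of_tendsto_ae {α : Type*} [MeasurableSpace α] {μ : Measure α}
    {F : ℕ → α → ℝ} {G : α → ℝ} {c : ℕ → ℝ} {d : ℝ} (hF : ∀ n, Integrable (F n) μ)
    (hF0 : ∀ n, 0 ≤ᵐ[μ] F n) (hG : ∀ᵐ x ∂μ, Tendsto (fun n => F n x) atTop (𝓝 (G x)))
    (hc : ∀ n, ∫ x, F n x ∂μ ≤ c n) (hd : Tendsto c atTop (𝓝 d)) :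
    Integrable G μ ∧ ∫ x, G x ∂μ ≤ d := by
  have hGm : AEStronglyMeasurable G μ :=
    aestronglyMeasurable_of_tendsto_ae atTop (fun n => (hF n).aestronglyMeasurable) hG
  have hG0 : 0 ≤ᵐ[μ] G := by
    filter_upwards [hG, ae_all_iff.2 hF0] with x hx h0
    exact ge_of_tendsto' hx h0
  have hd0 : 0 ≤ d := ge_of_tendsto' hd fun n => (integral_nonneg_of_ae (hF0 n)).trans (hc n)
  have key : ∫⁻ x, ENNReal.ofReal (G x) ∂μ ≤ ENNReal.ofReal d := by
    calc ∫⁻ x, ENNReal.ofReal (G x) ∂μ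
        = ∫⁻ x, liminf (fun n => ENNReal.ofReal (F n x)) atTop ∂μ := by
          refine lintegral_congr_ae ?_
          filter_upwards [hG] with x hx
          exact ((ENNReal.continuous_ofReal.tendsto _).comp hx).liminf_eq.symm
      _ ≤ liminf (fun n => ∫⁻ x, ENNReal.ofReal (F n x) ∂μ) atTop :=
          lintegral_liminf_le' fun n => (hF n).aemeasurable.ennreal_ofReal
      _ ≤ liminf (fun n => ENNReal.ofReal (c n)) atTop := by
          refine liminf_le_liminf (Eventually.of_forall fun n => ?_)
          rw [← ofReal_integral_eq_lintegral_ofReal (hF n) (hF0 n)]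
          exact ENNReal.ofReal_le_ofReal (hc n)
      _ = ENNReal.ofReal d := ((ENNReal.continuous_ofReal.tendsto _).comp hd).liminf_eq
  have hint : Integrable G μ :=
    ⟨hGm, (hasFiniteIntegral_iff_ofReal hG0).2 (key.trans_lt ENNReal.ofReal_lt_top)⟩
  refine ⟨hint, ?_⟩
  rwa [← ofReal_integral_eq_lintegral_ofReal hint hG0, ENNReal.ofReal_le_ofReal_iff hd0] at key

/-- The Hölder-type difference quotient whose square is the Gagliardo integrand. -/
def gagliardoQuotient (s : ℝ) (u : EuclideanSpace ℝ (Fin N) → ℝ)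
    (z : EuclideanSpace ℝ (Fin N) × EuclideanSpace ℝ (Fin N)) : ℝ :=
  (u z.1 - u z.2) / ‖z.1 - z.2‖ ^ (((N : ℝ) + 2 * s) / 2)

theorem gagliardoIntegrand_eq_mul (u v : EuclideanSpace ℝ (Fin N) → ℝ)
    (z : EuclideanSpace ℝ (Fin N) × EuclideanSpace ℝ (Fin N)) :
    gagliardoIntegrand s u v z = gagliardoQuotient s u z * gagliardoQuotient s v z := by
  have h : ‖z.1 - z.2‖ ^ ((N : ℝ) + 2 * s) = ‖z.1 - z.2‖ ^ (((N : ℝ) + 2 * s) / 2) *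
      ‖z.1 - z.2‖ ^ (((N : ℝ) + 2 * s) / 2) := by
    rw [← sq, ← Real.rpow_natCast, ← Real.rpow_mul (norm_nonneg _)]
    norm_num
  rw [gagliardoIntegrand, gagliardoQuotient, gagliardoQuotient, h, div_mul_div_comm]

theorem gagliardoIntegrand_self_nonneg (u : EuclideanSpace ℝ (Fin N) → ℝ)
    (z : EuclideanSpace ℝ (Fin N) × EuclideanSpace ℝ (Fin N)) :
    0 ≤ gagliardoIntegrand s u u z := by
  rw [gagliardoIntegrand_eq_mul]; exact mul_self_nonneg _

theorem gagliardoForm_self_nonneg (u : EuclideanSpace ℝ (Fin N) → ℝ) :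
    0 ≤ gagliardoForm s u u :=
  integral_nonneg (gagliardoIntegrand_self_nonneg u)

theorem ae_prod_of_ae {P : EuclideanSpace ℝ (Fin N) → Prop} (h : ∀ᵐ x, P x) :
    ∀ᵐ z : EuclideanSpace ℝ (Fin N) × EuclideanSpace ℝ (Fin N), P z.1 ∧ P z.2 :=
  (Measure.quasiMeasurePreserving_fst.ae h).and (Measure.quasiMeasurePreserving_snd.ae h)

theorem aestronglyMeasurable_gagliardoQuotient {u : EuclideanSpace ℝ (Fin N) → ℝ}
    (hu : AEStronglyMeasurable u volume) :
    AEStronglyMeasurable (gagliardoQuotient s u) volume := by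
  have h1 : AEStronglyMeasurable (fun z : EuclideanSpace ℝ (Fin N) × EuclideanSpace ℝ (Fin N) =>
      u z.1) volume := hu.comp_quasiMeasurePreserving Measure.quasiMeasurePreserving_fst
  have h2 : AEStronglyMeasurable (fun z : EuclideanSpace ℝ (Fin N) × EuclideanSpace ℝ (Fin N) =>
      u z.2) volume := hu.comp_quasiMeasurePreserving Measure.quasiMeasurePreserving_snd
  have h3 : Measurable (fun z : EuclideanSpace ℝ (Fin N) × EuclideanSpace ℝ (Fin N) =>
      ‖z.1 - z.2‖ ^ (((N : ℝ) + 2 * s) / 2)) := by fun_prop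
  exact ((h1.sub h2).aemeasurable.div h3.aemeasurable).aestronglyMeasurable

/-- With the seminorm expressed as an `L²` norm of `gagliardoQuotient`, closure under linear
combinations and integrability of mixed products follow from linearity in `u` and Hölder's
inequality. -/
theorem memHs_iff {u : EuclideanSpace ℝ (Fin N) → ℝ} :
    MemHs s u ↔ MemLp u 2 volume ∧ MemLp (gagliardoQuotient s u) 2 volume := by
  refine and_congr_right fun hu => ?_
  rw [memLp_two_iff_integrable_sq (aestronglyMeasurable_gagliardoQuotient hu.1)]
  refine integrable_congr (Eventually.of_forall fun z => ?_)
  simp only [gagliardoIntegrand_eq_mul, sq]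

theorem MemX0.memLp {u : EuclideanSpace ℝ (Fin N) → ℝ} (hu : MemX0 s Ω u) : MemLp u 2 volume :=
  hu.1.1

theorem MemX0.memLp_gagliardoQuotient {u : EuclideanSpace ℝ (Fin N) → ℝ} (hu : MemX0 s Ω u) :
    MemLp (gagliardoQuotient s u) 2 volume :=
  (memHs_iff.1 hu.1).2

theorem MemX0.integrable_gagliardoIntegrand {u v : EuclideanSpace ℝ (Fin N) → ℝ}
    (hu : MemX0 s Ω u) (hv : MemX0 s Ω v) : Integrable (gagliardoIntegrand s u v) volume := by
  refine (hu.memLp_gagliardoQuotient.integrable_mul hv.memLp_gagliardoQuotient).congr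
    (Eventually.of_forall fun z => ?_)
  simp only [gagliardoIntegrand_eq_mul, Pi.mul_apply]

theorem gagliardoQuotient_add_const_mul (u v : EuclideanSpace ℝ (Fin N) → ℝ) (c : ℝ)
    (z : EuclideanSpace ℝ (Fin N) × EuclideanSpace ℝ (Fin N)) :
    gagliardoQuotient s (fun x => u x + c * v x) z =
      gagliardoQuotient s u z + c * gagliardoQuotient s v z := by
  simp only [gagliardoQuotient]; ring

theorem MemX0.add_const_mul {u v : EuclideanSpace ℝ (Fin N) → ℝ}
    (hu : MemX0 s Ω u) (hv : MemX0 s Ω v) (c : ℝ) : MemX0 s Ω (fun x => u x + c * v x) := by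
  refine ⟨memHs_iff.2 ⟨hu.memLp.add (hv.memLp.const_mul c), ?_⟩, ?_⟩
  · exact (hu.memLp_gagliardoQuotient.add (hv.memLp_gagliardoQuotient.const_mul c)).ae_eq
      (Eventually.of_forall fun z => (gagliardoQuotient_add_const_mul u v c z).symm)
  · filter_upwards [hu.2, hv.2] with x h1 h2 hx
    simp [h1 hx, h2 hx]

theorem memX0_zero : MemX0 s Ω (fun _ => 0) := by
  refine ⟨memHs_iff.2 ⟨MemLp.zero, ?_⟩, by simp⟩
  have : gagliardoQuotient s (fun _ : EuclideanSpace ℝ (Fin N) => (0 : ℝ)) = fun _ => 0 := by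
    ext z; simp [gagliardoQuotient]
  rw [this]
  exact MemLp.zero

theorem MemX0.const_mul {u : EuclideanSpace ℝ (Fin N) → ℝ} (hu : MemX0 s Ω u) (c : ℝ) :
    MemX0 s Ω (fun x => c * u x) := by
  simpa using memX0_zero.add_const_mul hu c

theorem gagliardoForm_add_const_mul_self {u v : EuclideanSpace ℝ (Fin N) → ℝ}
    (hu : MemX0 s Ω u) (hv : MemX0 s Ω v) (c : ℝ) :
    gagliardoForm s (fun x => u x + c * v x) (fun x => u x + c * v x) =
      gagliardoForm s u u + 2 * c * gagliardoForm s u v + c ^ 2 * gagliardoForm s v v := by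
  have h1 := hu.integrable_gagliardoIntegrand hu
  have h2 := (hu.integrable_gagliardoIntegrand hv).const_mul (2 * c)
  have h3 := (hv.integrable_gagliardoIntegrand hv).const_mul (c ^ 2)
  simp only [gagliardoForm]
  rw [← integral_const_mul, ← integral_const_mul, ← integral_add h1 h2,
    ← integral_add (f := fun z => gagliardoIntegrand s u u z + 2 * c * gagliardoIntegrand s u v z)
      (h1.add h2) h3]
  refine integral_congr_ae (Eventually.of_forall fun z => ?_)
  simp only [gagliardoIntegrand]
  ring

theorem gagliardoForm_const_mul_self (u : EuclideanSpace ℝ (Fin N) → ℝ) (c : ℝ) :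
    gagliardoForm s (fun x => c * u x) (fun x => c * u x) = c ^ 2 * gagliardoForm s u u := by
  simp only [gagliardoForm]
  rw [← integral_const_mul]
  refine integral_congr_ae (Eventually.of_forall fun z => ?_)
  simp only [gagliardoIntegrand]
  ring

theorem gagliardoForm_congr_ae {u u' v v' : EuclideanSpace ℝ (Fin N) → ℝ}
    (hu : u =ᵐ[volume] u') (hv : v =ᵐ[volume] v') :
    gagliardoForm s u v = gagliardoForm s u' v' := by
  refine integral_congr_ae ?_
  filter_upwards [ae_prod_of_ae hu, ae_prod_of_ae hv] with z h1 h2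
  simp only [gagliardoIntegrand, h1.1, h1.2, h2.1, h2.2]

theorem gagliardoIntegrand_comp_le {u : EuclideanSpace ℝ (Fin N) → ℝ} {θ : ℝ → ℝ}
    (hθ : LipschitzWith 1 θ) (z : EuclideanSpace ℝ (Fin N) × EuclideanSpace ℝ (Fin N)) :
    gagliardoIntegrand s (fun x => θ (u x)) (fun x => θ (u x)) z ≤ gagliardoIntegrand s u u z := by
  have h : |θ (u z.1) - θ (u z.2)| ≤ |u z.1 - u z.2| := by
    simpa [Real.dist_eq] using hθ.dist_le_mul (u z.1) (u z.2)
  have h2 := sq_le_sq.2 h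
  simp only [gagliardoIntegrand, ← sq]
  gcongr

/-- Contractions fixing the origin act on `X_0^s`. -/
theorem MemX0.comp_lipschitz {u : EuclideanSpace ℝ (Fin N) → ℝ} (hu : MemX0 s Ω u) {θ : ℝ → ℝ}
    (hθ : LipschitzWith 1 θ) (h0 : θ 0 = 0) : MemX0 s Ω (fun x => θ (u x)) := by
  have hm : MemLp (fun x => θ (u x)) 2 volume := by
    refine hu.memLp.mono (hθ.continuous.comp_aestronglyMeasurable hu.memLp.1)
      (Eventually.of_forall fun x => ?_)
    simpa [Real.dist_eq, h0] using hθ.dist_le_mul (u x) 0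
  refine ⟨⟨hm, hu.1.2.mono' ?_ (Eventually.of_forall fun z => ?_)⟩, ?_⟩
  · refine ((aestronglyMeasurable_gagliardoQuotient (s := s) hm.1).mul
      (aestronglyMeasurable_gagliardoQuotient (s := s) hm.1)).congr
      (Eventually.of_forall fun z => ?_)
    simp only [gagliardoIntegrand_eq_mul, Pi.mul_apply]
  · rw [Real.norm_of_nonneg (gagliardoIntegrand_self_nonneg _ z)]
    exact gagliardoIntegrand_comp_le hθ z
  · filter_upwards [hu.2] with x h hx
    rw [h hx, h0]

theorem gagliardoForm_comp_le {u : EuclideanSpace ℝ (Fin N) → ℝ} (hu : MemX0 s Ω u) {θ : ℝ → ℝ}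
    (hθ : LipschitzWith 1 θ) (h0 : θ 0 = 0) :
    gagliardoForm s (fun x => θ (u x)) (fun x => θ (u x)) ≤ gagliardoForm s u u :=
  integral_mono (hu.comp_lipschitz hθ h0).1.2 hu.1.2 fun z => gagliardoIntegrand_comp_le hθ z

theorem tendsto_gagliardoIntegrand {u v : ℕ → EuclideanSpace ℝ (Fin N) → ℝ}
    {u₀ v₀ : EuclideanSpace ℝ (Fin N) → ℝ}
    (hu : ∀ᵐ x, Tendsto (fun n => u n x) atTop (𝓝 (u₀ x)))
    (hv : ∀ᵐ x, Tendsto (fun n => v n x) atTop (𝓝 (v₀ x))) :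
    ∀ᵐ z, Tendsto (fun n => gagliardoIntegrand s (u n) (v n) z) atTop
      (𝓝 (gagliardoIntegrand s u₀ v₀ z)) := by
  filter_upwards [ae_prod_of_ae hu, ae_prod_of_ae hv] with z h1 h2
  exact ((h1.1.sub h1.2).mul (h2.1.sub h2.2)).div_const _

/-- Lower semicontinuity of the Gagliardo energy along almost everywhere convergent sequences. -/
theorem gagliardoForm_le_of_tendsto_ae {u : ℕ → EuclideanSpace ℝ (Fin N) → ℝ}
    {v : EuclideanSpace ℝ (Fin N) → ℝ} (hu : ∀ n, MemX0 s Ω (u n))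
    (huv : ∀ᵐ x, Tendsto (fun n => u n x) atTop (𝓝 (v x))) {d : ℝ}
    (hd : Tendsto (fun n => gagliardoForm s (u n) (u n)) atTop (𝓝 d)) :
    Integrable (gagliardoIntegrand s v v) volume ∧ gagliardoForm s v v ≤ d :=
  integrable_and_integral_le_of_tendsto_ae (fun n => (hu n).1.2)
    (fun n => Eventually.of_forall (gagliardoIntegrand_self_nonneg (u n)))
    (tendsto_gagliardoIntegrand huv huv) (fun _ => le_rfl) hd

end Gagliardo

/-! ### Lipschitz cutoff functions in `X_0^s`. -/

section Cutoff

variable {N : ℕ} {s : ℝ} {Ω : Set (EuclideanSpace ℝ (Fin N))}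

/-- In polar coordinates the integrand is at most a constant times `r ^ (1 - 2s)` near `0`,
integrable since `s < 1`, and at most `r ^ (-1 - 2s)` at infinity, integrable since `s > 0`. -/
theorem integrable_min_sq_div_rpow (hs0 : 0 < s) (hs1 : s < 1) (hN : 0 < N) (L : ℝ) :
    Integrable (fun z : EuclideanSpace ℝ (Fin N) =>
      min (L ^ 2 * ‖z‖ ^ 2) 1 / ‖z‖ ^ ((N : ℝ) + 2 * s)) volume := by
  have : Nonempty (Fin N) := ⟨⟨0, hN⟩⟩
  have : Nontrivial (EuclideanSpace ℝ (Fin N)) := inferInstance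
  refine (integrable_fun_norm_addHaar volume
    (f := fun r : ℝ => min (L ^ 2 * r ^ 2) 1 / r ^ ((N : ℝ) + 2 * s))).2 ?_
  rw [finrank_euclideanSpace_fin, ← Set.Ioc_union_Ioi_eq_Ioi zero_le_one]
  have hpow : ∀ y : ℝ, 0 < y → y ^ (N - 1) = y ^ ((N : ℝ) - 1) := fun y hy => by
    rw [← Real.rpow_natCast, Nat.cast_sub hN, Nat.cast_one]
  have hmeas : Measurable (fun y : ℝ => y ^ (N - 1) • (min (L ^ 2 * y ^ 2) 1 /
      y ^ ((N : ℝ) + 2 * s))) := by fun_prop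
  refine IntegrableOn.union ?_ ?_
  · have h1 : IntegrableOn (fun y : ℝ => L ^ 2 * y ^ (1 - 2 * s)) (Set.Ioc 0 1) := by
      have := intervalIntegral.intervalIntegrable_rpow' (a := 0) (b := 1) (r := 1 - 2 * s)
        (by linarith)
      rw [intervalIntegrable_iff_integrableOn_Ioc_of_le zero_le_one] at this
      exact this.const_mul _
    refine Integrable.mono' h1 hmeas.aestronglyMeasurable ?_
    filter_upwards [ae_restrict_mem measurableSet_Ioc] with y hy
    have hy0 : 0 < y := hy.1
    rw [Real.norm_of_nonneg (by positivity), smul_eq_mul, hpow y hy0, mul_div_assoc']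
    rw [div_le_iff₀ (by positivity), mul_assoc, ← Real.rpow_add hy0]
    calc y ^ ((N : ℝ) - 1) * min (L ^ 2 * y ^ 2) 1 ≤ y ^ ((N : ℝ) - 1) * (L ^ 2 * y ^ 2) := by
          gcongr; exact min_le_left _ _
      _ = L ^ 2 * (y ^ ((N : ℝ) - 1) * y ^ (2 : ℝ)) := by rw [Real.rpow_two]; ring
      _ = L ^ 2 * y ^ (1 - 2 * s + ((N : ℝ) + 2 * s)) := by
          rw [← Real.rpow_add hy0]; congr 2; ring
      _ ≤ _ := le_rfl
  · have h1 : IntegrableOn (fun y : ℝ => y ^ (-1 - 2 * s)) (Set.Ioi 1) :=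
      integrableOn_Ioi_rpow_of_lt (by linarith) one_pos
    refine Integrable.mono' h1 hmeas.aestronglyMeasurable ?_
    filter_upwards [ae_restrict_mem measurableSet_Ioi] with y hy
    have hy0 : 0 < y := one_pos.trans hy
    rw [Real.norm_of_nonneg (by positivity), smul_eq_mul, hpow y hy0, mul_div_assoc']
    rw [div_le_iff₀ (by positivity), ← Real.rpow_add hy0]
    calc y ^ ((N : ℝ) - 1) * min (L ^ 2 * y ^ 2) 1 ≤ y ^ ((N : ℝ) - 1) * 1 := by
          gcongr; exact min_le_right _ _
      _ = y ^ (-1 - 2 * s + ((N : ℝ) + 2 * s)) := by rw [mul_one]; congr 1; ring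
      _ ≤ _ := le_rfl

/-- Lipschitz functions with values in `[0, 1]` vanishing outside a bounded set lie in `X_0^s`. -/
theorem memX0_of_lipschitz (hs0 : 0 < s) (hs1 : s < 1) (hN : 0 < N) (hΩm : MeasurableSet Ω)
    (hΩb : Bornology.IsBounded Ω) {ψ : EuclideanSpace ℝ (Fin N) → ℝ} {K : NNReal}
    (hψ : LipschitzWith K ψ) (h01 : ∀ x, ψ x ∈ Set.Icc (0 : ℝ) 1) (hout : ∀ x, x ∉ Ω → ψ x = 0) :
    MemX0 s Ω ψ := by
  have hind : Integrable (Ω.indicator fun _ => (1 : ℝ)) volume :=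
    (integrable_indicator_iff hΩm).2 (integrableOn_const hΩb.measure_lt_top.ne)
  have hker := integrable_min_sq_div_rpow (s := s) hs0 hs1 hN (K : ℝ)
  have hψm : AEStronglyMeasurable ψ volume := hψ.continuous.aestronglyMeasurable
  have h2 : MemLp ψ 2 volume := by
    rw [memLp_two_iff_integrable_sq hψm]
    refine hind.mono' (hψ.continuous.pow 2).aestronglyMeasurable (Eventually.of_forall fun x => ?_)
    by_cases hx : x ∈ Ω
    · have := h01 x
      rw [Set.indicator_of_mem hx, Real.norm_of_nonneg (by positivity)]
      exact pow_le_one₀ this.1 this.2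
    · rw [Set.indicator_of_notMem hx, hout x hx]; simp
  -- The Gagliardo integrand of `ψ` vanishes unless `x` or `y` lies in `Ω`, so it is dominated by
  -- the kernel times the sum of the two indicators; each summand is a convolution integrand of
  -- integrable functions.
  have hA := hind.convolution_integrand (ContinuousLinearMap.mul ℝ ℝ) hker
  have hB := hA.swap
  refine ⟨⟨h2, (hA.add hB).mono' ?_ (Eventually.of_forall fun z => ?_)⟩,
    Eventually.of_forall hout⟩
  · refine ((aestronglyMeasurable_gagliardoQuotient (s := s) hψm).mul
      (aestronglyMeasurable_gagliardoQuotient (s := s) hψm)).congr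
      (Eventually.of_forall fun z => ?_)
    simp only [gagliardoIntegrand_eq_mul, Pi.mul_apply]
  · obtain ⟨x, y⟩ := z
    rw [Real.norm_of_nonneg (gagliardoIntegrand_self_nonneg _ _)]
    simp only [Pi.add_apply, Function.comp_apply, Prod.swap_prod_mk,
      ContinuousLinearMap.mul_apply', norm_sub_rev y x, gagliardoIntegrand, ← sq]
    have hk : (ψ x - ψ y) ^ 2 / ‖x - y‖ ^ ((N : ℝ) + 2 * s) ≤
        min ((K : ℝ) ^ 2 * ‖x - y‖ ^ 2) 1 / ‖x - y‖ ^ ((N : ℝ) + 2 * s) := by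
      have h1 := h01 x
      have h2 := h01 y
      gcongr
      refine le_min ?_ ?_
      · rw [← mul_pow]
        refine sq_le_sq.2 ?_
        rw [abs_of_nonneg (a := (K : ℝ) * _) (by positivity)]
        simpa [dist_eq_norm] using hψ.dist_le_mul x y
      · refine (sq_le_one_iff_abs_le_one _).2 (abs_le.2 ⟨?_, ?_⟩) <;> linarith [h1.1, h1.2, h2.1, h2.2]
    have hk0 : 0 ≤ min ((K : ℝ) ^ 2 * ‖x - y‖ ^ 2) 1 / ‖x - y‖ ^ ((N : ℝ) + 2 * s) := by positivity
    by_cases hx : x ∈ Ω <;> by_cases hy : y ∈ Ω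
    · simp only [Set.indicator_of_mem hx, Set.indicator_of_mem hy]; linarith
    · simp only [Set.indicator_of_mem hx, Set.indicator_of_notMem hy]; linarith
    · simp only [Set.indicator_of_notMem hx, Set.indicator_of_mem hy]; linarith
    · simp only [Set.indicator_of_notMem hx, Set.indicator_of_notMem hy, hout x hx, hout y hy]
      simp

/-- A bounded nonempty open set carries a cutoff function in `X_0^s` which is positive in the set
and equal to one on a subset of positive measure. -/
theorem exists_cutoff (hs0 : 0 < s) (hs1 : s < 1) (hN : 0 < N) (hΩo : IsOpen Ω)
    (hΩn : Ω.Nonempty) (hΩb : Bornology.IsBounded Ω) :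
    ∃ ψ : EuclideanSpace ℝ (Fin N) → ℝ, MemX0 s Ω ψ ∧
      (∀ x, ψ x ∈ Set.Icc (0 : ℝ) 1) ∧ (∀ x ∈ Ω, 0 < ψ x) ∧
      ∃ B ⊆ Ω, MeasurableSet B ∧ 0 < volume B ∧ ∀ x ∈ B, ψ x = 1 := by
  have : Nonempty (Fin N) := ⟨⟨0, hN⟩⟩
  have : Nontrivial (EuclideanSpace ℝ (Fin N)) := inferInstance
  obtain ⟨x₀, hx₀⟩ := hΩn
  -- Needed because `Metric.infDist` to the empty set is `0` by convention.
  have hne : (Ωᶜ).Nonempty := by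
    rw [Set.nonempty_compl]
    rintro rfl
    exact NormedSpace.unbounded_univ ℝ (EuclideanSpace ℝ (Fin N)) hΩb
  have hpos : ∀ x ∈ Ω, 0 < Metric.infDist x Ωᶜ := fun x hx =>
    (hΩo.isClosed_compl.notMem_iff_infDist_pos hne).1 (by simpa using hx)
  set d := Metric.infDist x₀ Ωᶜ with hd
  have hd0 : 0 < d := hpos x₀ hx₀
  -- The slope `2 / d` makes the cutoff equal to one where the distance to `Ωᶜ` exceeds `d / 2`, an
  -- open set containing `x₀`.
  have hlip : LipschitzWith (Real.toNNReal (2 / d))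
      (fun x => min 1 (2 / d * Metric.infDist x Ωᶜ)) := by
    refine LipschitzWith.const_min ?_ 1
    refine LipschitzWith.of_dist_le_mul fun x y => ?_
    rw [Real.coe_toNNReal _ (by positivity), Real.dist_eq, ← mul_sub, abs_mul,
      abs_of_nonneg (by positivity : 0 ≤ 2 / d)]
    have := (Metric.lipschitz_infDist_pt Ωᶜ).dist_le_mul x y
    rw [NNReal.coe_one, one_mul, Real.dist_eq] at this
    gcongr
  have h01 : ∀ x, min 1 (2 / d * Metric.infDist x Ωᶜ) ∈ Set.Icc (0 : ℝ) 1 := fun x =>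
    ⟨le_min zero_le_one (mul_nonneg (by positivity) Metric.infDist_nonneg), min_le_left _ _⟩
  refine ⟨_, memX0_of_lipschitz hs0 hs1 hN hΩo.measurableSet hΩb hlip h01 ?_, h01,
    ?_, {x | d / 2 < Metric.infDist x Ωᶜ}, ?_, ?_, ?_, ?_⟩
  · intro x hx
    rw [Metric.infDist_zero_of_mem (show x ∈ Ωᶜ from hx)]; simp
  · intro x hx
    exact lt_min one_pos (mul_pos (by positivity) (hpos x hx))
  · intro x hx
    by_contra hxΩ
    have : Metric.infDist x Ωᶜ = 0 := Metric.infDist_zero_of_mem hxΩ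
    simp only [Set.mem_ofPred_eq, this] at hx
    linarith
  · exact (isOpen_lt continuous_const (Metric.continuous_infDist_pt _)).measurableSet
  · exact (isOpen_lt continuous_const (Metric.continuous_infDist_pt _)).measure_pos volume
      ⟨x₀, by simp only [Set.mem_ofPred_eq, ← hd]; linarith⟩
  · intro x hx
    refine min_eq_left ?_
    have hx' : d / 2 < Metric.infDist x Ωᶜ := hx
    calc (1 : ℝ) = 2 / d * (d / 2) := by field_simp
      _ ≤ _ := by gcongr

end Cutoff

/-! ### Compactness of bounded sequences of uniformly bounded functions. -/

section Compactness

open scoped ENNReal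

variable {N : ℕ} {s : ℝ} {Ω : Set (EuclideanSpace ℝ (Fin N))}

/-- Parallelogram identity, with the energy of the sum dropped. -/
theorem gagliardoForm_sub_le {u v : EuclideanSpace ℝ (Fin N) → ℝ} (hu : MemX0 s Ω u)
    (hv : MemX0 s Ω v) :
    gagliardoForm s (fun x => u x - v x) (fun x => u x - v x) ≤
      2 * gagliardoForm s u u + 2 * gagliardoForm s v v := by
  have h1 := gagliardoForm_add_const_mul_self hu hv 1
  have h2 := gagliardoForm_add_const_mul_self hu hv (-1)
  have h3 := gagliardoForm_self_nonneg (s := s) (fun x => u x + 1 * v x)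
  have h4 : (fun x => u x + -1 * v x) = fun x => u x - v x := by ext x; ring
  rw [h4] at h2
  rw [h2]
  linarith

theorem MemX0.sub {u v : EuclideanSpace ℝ (Fin N) → ℝ} (hu : MemX0 s Ω u) (hv : MemX0 s Ω v) :
    MemX0 s Ω (fun x => u x - v x) := by
  have h4 : (fun x => u x + -1 * v x) = fun x => u x - v x := by ext x; ring
  rw [← h4]; exact hu.add_const_mul hv (-1)

theorem aestronglyMeasurable_setIntegral_ball {v : EuclideanSpace ℝ (Fin N) → ℝ}
    (hv : AEStronglyMeasurable v volume) (r : ℝ) :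
    AEStronglyMeasurable (fun x => ∫ y in Metric.ball x r, v y) volume := by
  have h1 : AEStronglyMeasurable (fun z : EuclideanSpace ℝ (Fin N) × EuclideanSpace ℝ (Fin N) =>
      v z.2) (volume.prod volume) :=
    hv.comp_quasiMeasurePreserving Measure.quasiMeasurePreserving_snd
  have hS : MeasurableSet {z : EuclideanSpace ℝ (Fin N) × EuclideanSpace ℝ (Fin N) |
      dist z.2 z.1 < r} := measurableSet_lt (by fun_prop) measurable_const
  refine (h1.indicator hS).integral_prod_right'.congr (Eventually.of_forall fun x => ?_)
  simp only
  rw [← integral_indicator Metric.isOpen_ball.measurableSet]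
  refine integral_congr_ae (Eventually.of_forall fun y => ?_)
  simp only [Set.indicator, Set.mem_ofPred_eq, Metric.mem_ball]

theorem integrableOn_of_abs_le {v : EuclideanSpace ℝ (Fin N) → ℝ}
    (hv : AEStronglyMeasurable v volume) {b : ℝ} (hb : ∀ x, |v x| ≤ b)
    {S : Set (EuclideanSpace ℝ (Fin N))} (hS : volume S ≠ ⊤) : IntegrableOn v S volume :=
  Measure.integrableOn_of_bounded hS hv (Eventually.of_forall hb)

theorem abs_setIntegral_ball_le {v : EuclideanSpace ℝ (Fin N) → ℝ} {b : ℝ}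
    (hb : ∀ x, |v x| ≤ b) (x : EuclideanSpace ℝ (Fin N)) (r : ℝ) :
    |∫ y in Metric.ball x r, v y| ≤
      b * volume.real (Metric.ball (0 : EuclideanSpace ℝ (Fin N)) r) := by
  have h := norm_setIntegral_le_of_norm_le_const (μ := volume) (s := Metric.ball x r) (f := v)
    (C := b) measure_ball_lt_top fun y _ => hb y
  rwa [Real.norm_eq_abs, measureReal_def, Measure.addHaar_ball_center, ← measureReal_def] at h

/-- The `L²` norm is controlled by the Gagliardo energy and the averages over small balls. -/
theorem measureReal_ball_mul_integral_sq_le (hs0 : 0 < s) (hΩm : MeasurableSet Ω)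
    (hΩf : volume Ω ≠ ⊤) {v : EuclideanSpace ℝ (Fin N) → ℝ} (hv : MemX0 s Ω v) {b : ℝ}
    (hb : ∀ x, |v x| ≤ b) {r : ℝ} (hr : 0 < r) :
    volume.real (Metric.ball (0 : EuclideanSpace ℝ (Fin N)) r) * ∫ x, v x ^ 2 ≤
      r ^ ((N : ℝ) + 2 * s) * gagliardoForm s v v +
        2 * b * ∫ x in Ω, |∫ y in Metric.ball x r, v y| := by
  set β := volume.real (Metric.ball (0 : EuclideanSpace ℝ (Fin N)) r) with hβ
  set q := (N : ℝ) + 2 * s with hq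
  have hq0 : 0 < q := by positivity
  have hb0 : 0 ≤ b := (abs_nonneg _).trans (hb 0)
  have hJ : Integrable (gagliardoIntegrand s v v) (volume.prod volume) := hv.1.2
  have hAm := aestronglyMeasurable_setIntegral_ball hv.memLp.1 r
  have hAi : IntegrableOn (fun x => |∫ y in Metric.ball x r, v y|) Ω volume :=
    (integrableOn_of_abs_le hAm (fun x => abs_setIntegral_ball_le hb x r) hΩf).abs
  have hpt : ∀ᵐ x, β * v x ^ 2 ≤ r ^ q * (∫ y, gagliardoIntegrand s v v (x, y)) +
      2 * b * Ω.indicator (fun x => |∫ y in Metric.ball x r, v y|) x := by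
    filter_upwards [hJ.prod_right_ae, hv.2] with x hx hout
    have hvball : IntegrableOn v (Metric.ball x r) volume :=
      integrableOn_of_abs_le hv.memLp.1 hb measure_ball_lt_top.ne
    -- Use `v x ^ 2 ≤ (v x - v y) ^ 2 + 2 * v x * v y` and bound the kernel denominator by `r ^ q`
    -- on the ball. Integrating in `y` and then in `x` gives the claim; the average enters only over
    -- `Ω`, since `v` vanishes elsewhere.
    have hcomp : ∀ y ∈ Metric.ball x r, v x ^ 2 ≤
        r ^ q * gagliardoIntegrand s v v (x, y) + 2 * v x * v y := by
      intro y hy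
      have h1 : (v x - v y) ^ 2 ≤ r ^ q * gagliardoIntegrand s v v (x, y) := by
        simp only [gagliardoIntegrand, ← sq]
        by_cases hxy : x = y
        · simp [hxy]
        · have h0 : 0 < ‖x - y‖ := norm_pos_iff.2 (sub_ne_zero.2 hxy)
          have h2 : ‖x - y‖ ^ q ≤ r ^ q := by
            rw [Metric.mem_ball, dist_comm, dist_eq_norm] at hy
            exact Real.rpow_le_rpow h0.le hy.le hq0.le
          have h3 : 0 < ‖x - y‖ ^ q := by positivity
          rw [mul_div_assoc', le_div_iff₀ h3, mul_comm]
          gcongr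
      nlinarith [sq_nonneg (v y)]
    have h1 := setIntegral_mono_on (integrableOn_const (C := v x ^ 2) measure_ball_lt_top.ne)
      ((hx.integrableOn.const_mul (r ^ q)).add (hvball.const_mul (2 * v x)))
      Metric.isOpen_ball.measurableSet hcomp
    simp only [Pi.add_apply] at h1
    rw [setIntegral_const, integral_add (hx.integrableOn.const_mul (r ^ q))
      (hvball.const_mul (2 * v x)), integral_const_mul, integral_const_mul, measureReal_def,
      Measure.addHaar_ball_center, ← measureReal_def, smul_eq_mul] at h1
    have h2 : ∫ y in Metric.ball x r, gagliardoIntegrand s v v (x, y) ≤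
        ∫ y, gagliardoIntegrand s v v (x, y) :=
      setIntegral_le_integral hx
        (Eventually.of_forall fun y => gagliardoIntegrand_self_nonneg v (x, y))
    have h3 : v x * (∫ y in Metric.ball x r, v y) ≤
        b * Ω.indicator (fun x => |∫ y in Metric.ball x r, v y|) x := by
      by_cases hxΩ : x ∈ Ω
      · rw [Set.indicator_of_mem hxΩ]
        refine (le_abs_self _).trans ?_
        rw [abs_mul]
        gcongr
        exact hb x
      · simp [hout hxΩ, hxΩ]
    have h4 : 0 ≤ r ^ q := by positivity
    have h5 := mul_le_mul_of_nonneg_left h2 h4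
    linarith
  have hsq : Integrable (fun x => v x ^ 2) volume := hv.memLp.integrable_sq
  have hI1 : Integrable (fun x => r ^ q * ∫ y, gagliardoIntegrand s v v (x, y)) volume :=
    hJ.integral_prod_left.const_mul _
  have hI2 : Integrable (fun x => 2 * b *
      Ω.indicator (fun x => |∫ y in Metric.ball x r, v y|) x) volume :=
    ((integrable_indicator_iff hΩm).2 hAi).const_mul _
  have h := integral_mono_ae (hsq.const_mul β) (hI1.add hI2) hpt
  simp only [Pi.add_apply] at h
  rw [integral_const_mul, integral_add hI1 hI2, integral_const_mul, integral_const_mul,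
    integral_indicator hΩm] at h
  rwa [gagliardoForm, Measure.volume_eq_prod, integral_prod _ hJ]

theorem norm_toLp_sq {v : EuclideanSpace ℝ (Fin N) → ℝ} (hv : MemLp v 2 volume) :
    ‖hv.toLp v‖ ^ 2 = ∫ x, v x ^ 2 := by
  rw [← real_inner_self_eq_norm_sq, L2.inner_def]
  refine integral_congr_ae ?_
  filter_upwards [hv.coeFn_toLp] with x hx
  simp [hx, sq]

/-- Bounded sequences in `L²` have subsequences along which all integrals over sets of finite
measure converge. -/
theorem exists_subseq_tendsto_setIntegral {u : ℕ → EuclideanSpace ℝ (Fin N) → ℝ}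
    (hu : ∀ n, MemLp (u n) 2 volume) {R : ℝ} (hR : ∀ n, ∫ x, u n x ^ 2 ≤ R) :
    ∃ φ : ℕ → ℕ, StrictMono φ ∧ ∀ S : Set (EuclideanSpace ℝ (Fin N)), MeasurableSet S →
      volume S ≠ ⊤ → ∃ l : ℝ, Tendsto (fun n => ∫ x in S, u (φ n) x) atTop (𝓝 l) := by
  have : Fact ((2 : ℝ≥0∞) ≠ ⊤) := ⟨by simp⟩
  set U : ℕ → Lp ℝ 2 (volume : Measure (EuclideanSpace ℝ (Fin N))) := fun n => (hu n).toLp (u n)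
  have hU : ∀ n, ‖U n‖ ≤ Real.sqrt R := fun n =>
    Real.le_sqrt_of_sq_le (by rw [norm_toLp_sq]; exact hR n)
  -- Riesz representation moves the sequence into the dual, where closed balls are weak-*
  -- sequentially compact; indicators of sets of finite measure then serve as test vectors.
  set T : ℕ → WeakDual ℝ (Lp ℝ 2 (volume : Measure (EuclideanSpace ℝ (Fin N)))) := fun n =>
    StrongDual.toWeakDual (InnerProductSpace.toDual ℝ _ (U n))
  obtain ⟨w, -, φ, hφ, hw⟩ := WeakDual.isSeqCompact_closedBall ℝ
    (Lp ℝ 2 (volume : Measure (EuclideanSpace ℝ (Fin N)))) 0 (Real.sqrt R) (x := T) (fun n => by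
      rw [Set.mem_preimage, mem_closedBall_zero_iff]
      change ‖InnerProductSpace.toDual ℝ _ (U n)‖ ≤ _
      rw [LinearIsometryEquiv.norm_map]
      exact hU n)
  refine ⟨φ, hφ, fun S hS hSf => ⟨w (indicatorConstLp 2 hS hSf (1 : ℝ)), ?_⟩⟩
  refine (((WeakDual.eval_continuous (indicatorConstLp 2 hS hSf (1 : ℝ))).tendsto w).comp hw).congr
    fun n => ?_
  change inner ℝ (U (φ n)) (indicatorConstLp 2 hS hSf (1 : ℝ)) = _
  rw [real_inner_comm, L2.inner_indicatorConstLp_one]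
  exact integral_congr_ae (ae_restrict_of_ae (hu (φ n)).coeFn_toLp)

theorem integral_sq_le_of_abs_le (hΩm : MeasurableSet Ω) (hΩf : volume Ω ≠ ⊤)
    {v : EuclideanSpace ℝ (Fin N) → ℝ} (hv : MemX0 s Ω v) {b : ℝ} (hb : ∀ x, |v x| ≤ b) :
    ∫ x, v x ^ 2 ≤ b ^ 2 * volume.real Ω := by
  have h1 : ∫ x, v x ^ 2 ≤ ∫ x, Ω.indicator (fun _ => b ^ 2) x := by
    refine integral_mono_ae hv.memLp.integrable_sq
      ((integrable_indicator_iff hΩm).2 (integrableOn_const hΩf)) ?_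
    filter_upwards [hv.2] with x hx
    by_cases h : x ∈ Ω
    · rw [Set.indicator_of_mem h]
      exact sq_le_sq.2 ((hb x).trans (le_abs_self b))
    · simp [hx h, h]
  rwa [integral_indicator hΩm, setIntegral_const, smul_eq_mul, mul_comm] at h1

/-- Compactness of bounded subsets of `X_0^s` consisting of uniformly bounded functions. -/
theorem exists_subseq_tendsto_ae (hs0 : 0 < s) (hN : 0 < N) (hΩm : MeasurableSet Ω)
    (hΩf : volume Ω ≠ ⊤) {u : ℕ → EuclideanSpace ℝ (Fin N) → ℝ} (hu : ∀ n, MemX0 s Ω (u n))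
    {b C : ℝ} (hb : ∀ n x, |u n x| ≤ b) (hC : ∀ n, gagliardoForm s (u n) (u n) ≤ C) :
    ∃ φ : ℕ → ℕ, StrictMono φ ∧ ∃ v : EuclideanSpace ℝ (Fin N) → ℝ,
      ∀ᵐ x, Tendsto (fun n => u (φ n) x) atTop (𝓝 (v x)) := by
  have : Nonempty (Fin N) := ⟨⟨0, hN⟩⟩
  have : Nontrivial (EuclideanSpace ℝ (Fin N)) := inferInstance
  obtain ⟨φ, hφ, hconv⟩ := exists_subseq_tendsto_setIntegral (fun n => (hu n).memLp)
    fun n => integral_sq_le_of_abs_le hΩm hΩf (hu n) (hb n)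
  have hb0 : 0 ≤ b := (abs_nonneg _).trans (hb 0 0)
  have hC0 : 0 ≤ C := (gagliardoForm_self_nonneg (u 0)).trans (hC 0)
  -- Differences over pairs of indices are used to prove the Cauchy property in `L²`, without
  -- identifying a limit beforehand.
  set d : ℕ × ℕ → EuclideanSpace ℝ (Fin N) → ℝ := fun p x => u (φ p.1) x - u (φ p.2) x with hd
  have hdm : ∀ p, MemX0 s Ω (d p) := fun p => (hu _).sub (hu _)
  have hdb : ∀ p x, |d p x| ≤ 2 * b := fun p x => by
    have h1 := abs_le.1 (hb (φ p.1) x)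
    have h2 := abs_le.1 (hb (φ p.2) x)
    exact abs_le.2 ⟨by simp only [hd]; linarith, by simp only [hd]; linarith⟩
  have hdC : ∀ p, gagliardoForm s (d p) (d p) ≤ 4 * C := fun p => by
    have := gagliardoForm_sub_le (hu (φ p.1)) (hu (φ p.2))
    linarith [hC (φ p.1), hC (φ p.2)]
  have havg : ∀ r : ℝ, Tendsto (fun p => ∫ x in Ω, |∫ y in Metric.ball x r, d p y|) atTop (𝓝 0) := by
    intro r
    have h0 : (0 : ℝ) = ∫ x in Ω, (0 : ℝ) := by simp
    rw [h0]
    refine tendsto_integral_filter_of_dominated_convergence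
      (fun _ => 2 * b * volume.real (Metric.ball (0 : EuclideanSpace ℝ (Fin N)) r))
      (Eventually.of_forall fun p =>
        (aestronglyMeasurable_setIntegral_ball (hdm p).memLp.1 r).restrict.norm)
      (Eventually.of_forall fun p => Eventually.of_forall fun x => ?_)
      (integrableOn_const hΩf) (Eventually.of_forall fun x => ?_)
    · rw [Real.norm_eq_abs, abs_abs]
      exact abs_setIntegral_ball_le (hdb p) x r
    · obtain ⟨l, hl⟩ := hconv (Metric.ball x r) Metric.isOpen_ball.measurableSet
        measure_ball_lt_top.ne
      have h1 : Tendsto (fun p : ℕ × ℕ => (∫ y in Metric.ball x r, u (φ p.1) y) -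
          ∫ y in Metric.ball x r, u (φ p.2) y) atTop (𝓝 (l - l)) := by
        rw [← prod_atTop_atTop_eq]
        exact (hl.comp tendsto_fst).sub (hl.comp tendsto_snd)
      rw [sub_self] at h1
      have h2 := h1.abs
      rw [abs_zero] at h2
      refine h2.congr fun p => ?_
      rw [← integral_sub]
      · exact integrableOn_of_abs_le (hu _).memLp.1 (hb _) measure_ball_lt_top.ne
      · exact integrableOn_of_abs_le (hu _).memLp.1 (hb _) measure_ball_lt_top.ne
  have hL2 : ∀ ε > 0, ∀ᶠ p in atTop, ∫ x, d p x ^ 2 < ε := by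
    intro ε hε
    set β := volume.real (Metric.ball (0 : EuclideanSpace ℝ (Fin N)) 1) with hβ
    have hβ0 : 0 < β := ENNReal.toReal_pos (Metric.measure_ball_pos _ _ one_pos).ne'
      measure_ball_lt_top.ne
    -- The radius is fixed first, so that after division by `r ^ N` the energy term takes half of
    -- the allowed error uniformly in `p`; then `p` is taken large for the averages at that radius.
    have hr : ∃ r : ℝ, 0 < r ∧ r ^ (2 * s) * (4 * C) < β * (ε / 2) := by
      have h1 : Tendsto (fun r : ℝ => r ^ (2 * s) * (4 * C)) (𝓝[>] 0) (𝓝 (0 * (4 * C))) := by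
        refine Tendsto.mul_const _ (tendsto_nhdsWithin_of_tendsto_nhds ?_)
        have := (Real.continuous_rpow_const (q := 2 * s) (by linarith)).tendsto 0
        rwa [Real.zero_rpow (by linarith)] at this
      rw [zero_mul] at h1
      exact ((h1.eventually_lt_const (u := β * (ε / 2)) (by positivity)).and
        self_mem_nhdsWithin).exists.imp fun r h => ⟨h.2, h.1⟩
    obtain ⟨r, hr0, hr⟩ := hr
    have hball : volume.real (Metric.ball (0 : EuclideanSpace ℝ (Fin N)) r) = r ^ N * β := by
      rw [measureReal_def, Measure.addHaar_ball _ _ hr0.le, ENNReal.toReal_mul,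
        ENNReal.toReal_ofReal (by positivity), finrank_euclideanSpace_fin, hβ, measureReal_def]
    have hsmall := ((havg r).const_mul (2 * (2 * b))).eventually_lt_const
      (u := r ^ N * β * (ε / 2)) (by rw [mul_zero]; positivity)
    filter_upwards [hsmall] with p hp
    have h1 := measureReal_ball_mul_integral_sq_le hs0 hΩm hΩf (hdm p) (hdb p) hr0
    rw [hball, Real.rpow_add hr0, Real.rpow_natCast] at h1
    have h2 : r ^ N * r ^ (2 * s) * gagliardoForm s (d p) (d p) ≤ r ^ N * (β * (ε / 2)) := by
      rw [mul_assoc]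
      have := hdC p
      refine mul_le_mul_of_nonneg_left (le_trans ?_ hr.le) (by positivity)
      gcongr
    have h3 : r ^ N * β * ∫ x, d p x ^ 2 < r ^ N * β * ε := by linarith
    exact lt_of_mul_lt_mul_left h3 (by positivity)
  set U : ℕ → Lp ℝ 2 (volume : Measure (EuclideanSpace ℝ (Fin N))) := fun n =>
    (hu (φ n)).memLp.toLp (u (φ n)) with hU
  have hcauchy : CauchySeq U := by
    refine Metric.cauchySeq_iff.2 fun ε hε => ?_
    obtain ⟨n₀, hn₀⟩ := eventually_atTop_prod_self.1 (hL2 (ε ^ 2) (by positivity))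
    refine ⟨n₀, fun m hm n hn => ?_⟩
    have h1 := hn₀ m n hm hn
    have h2 : U m - U n = (hdm (m, n)).memLp.toLp (d (m, n)) :=
      (MemLp.toLp_sub (hu (φ m)).memLp (hu (φ n)).memLp).symm
    rw [dist_eq_norm, h2]
    rw [← norm_toLp_sq (hdm (m, n)).memLp] at h1
    exact lt_of_pow_lt_pow_left₀ 2 hε.le h1
  obtain ⟨W, hW⟩ := cauchySeq_tendsto_of_complete hcauchy
  obtain ⟨ns, hns, hae⟩ := (tendstoInMeasure_of_tendsto_Lp hW).exists_seq_tendsto_ae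
  refine ⟨φ ∘ ns, hφ.comp hns, W, ?_⟩
  filter_upwards [hae, ae_all_iff.2 fun n => (hu (φ n)).memLp.coeFn_toLp] with x hx h
  refine hx.congr fun n => ?_
  exact h (ns n)

end Compactness

/-! ### Minimization of the energy and its Euler–Lagrange equation. -/

section Minimization

variable {N : ℕ} {s : ℝ} {Ω : Set (EuclideanSpace ℝ (Fin N))} {g : ℝ → ℝ} {b M : ℝ}

theorem lipschitzWith_max_zero_min (b : ℝ) : LipschitzWith 1 (fun t : ℝ => max 0 (min t b)) :=
  (LipschitzWith.id.min_const b).const_max 0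

theorem hasDerivAt_primitive (hg : Continuous g) (t : ℝ) :
    HasDerivAt (fun t => ∫ τ in (0 : ℝ)..t, g τ) (g t) t :=
  intervalIntegral.integral_hasDerivAt_right (hg.intervalIntegrable _ _)
    (hg.stronglyMeasurableAtFilter _ _) hg.continuousAt

theorem continuous_primitive_of_continuous (hg : Continuous g) :
    Continuous fun t => ∫ τ in (0 : ℝ)..t, g τ :=
  continuous_iff_continuousAt.2 fun t => (hasDerivAt_primitive hg t).continuousAt

theorem abs_primitive_le (hM : ∀ t, |g t| ≤ M) (t : ℝ) : |∫ τ in (0 : ℝ)..t, g τ| ≤ M * |t| := by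
  simpa using intervalIntegral.norm_integral_le_of_norm_le_const (a := 0) (b := t) (f := g)
    (C := M) fun x _ => hM x

theorem MemX0.integrableOn (hΩf : volume Ω ≠ ⊤) {u : EuclideanSpace ℝ (Fin N) → ℝ}
    (hu : MemX0 s Ω u) : IntegrableOn u Ω volume := by
  have : IsFiniteMeasure (volume.restrict Ω) := isFiniteMeasure_restrict.2 hΩf
  exact (hu.memLp.restrict Ω).integrable one_le_two

theorem integrableOn_primitive_comp (hΩf : volume Ω ≠ ⊤) (hg : Continuous g)
    (hM : ∀ t, |g t| ≤ M) {u : EuclideanSpace ℝ (Fin N) → ℝ} (hu : MemX0 s Ω u) :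
    IntegrableOn (fun x => ∫ τ in (0 : ℝ)..u x, g τ) Ω volume := by
  refine ((hu.integrableOn hΩf).abs.const_mul M).mono'
    ((continuous_primitive_of_continuous hg).comp_aestronglyMeasurable hu.memLp.1.restrict)
    (Eventually.of_forall fun x => abs_primitive_le hM (u x))

/-- The energy functional of the equation `(-Δ)^s u = g(u)` in `Ω`. -/
def energy (s : ℝ) (Ω : Set (EuclideanSpace ℝ (Fin N))) (g : ℝ → ℝ)
    (u : EuclideanSpace ℝ (Fin N) → ℝ) : ℝ :=
  gagliardoForm s u u / 2 - ∫ x in Ω, ∫ τ in (0 : ℝ)..u x, g τ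

/-- If truncation to `[0, b]` does not decrease the primitive of `g`, the energy functional has a
global minimizer with values in `[0, b]`. -/
theorem exists_energy_minimizer (hs0 : 0 < s) (hN : 0 < N) (hΩm : MeasurableSet Ω)
    (hΩf : volume Ω ≠ ⊤) (hb : 0 ≤ b) (hg : Continuous g) (hM : ∀ t, |g t| ≤ M)
    (hG : ∀ t, ∫ τ in (0 : ℝ)..t, g τ ≤ ∫ τ in (0 : ℝ)..max 0 (min t b), g τ) :
    ∃ v : EuclideanSpace ℝ (Fin N) → ℝ, MemX0 s Ω v ∧ (∀ x, v x ∈ Set.Icc 0 b) ∧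
      ∀ w, MemX0 s Ω w → energy s Ω g v ≤ energy s Ω g w := by
  have hM0 : 0 ≤ M := (abs_nonneg _).trans (hM 0)
  have hclamp0 : max 0 (min 0 b) = 0 := by simp
  have hclampI : ∀ t, max 0 (min t b) ∈ Set.Icc 0 b := fun t =>
    ⟨le_max_left _ _, max_le hb (min_le_right _ _)⟩
  have hclampF : ∀ t ∈ Set.Icc 0 b, max 0 (min t b) = t := fun t ht => by
    rw [min_eq_left ht.2, max_eq_right ht.1]
  have hGb : ∀ t ∈ Set.Icc 0 b, |∫ τ in (0 : ℝ)..t, g τ| ≤ M * b := fun t ht => by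
    refine (abs_primitive_le hM t).trans ?_
    rw [abs_of_nonneg ht.1]
    exact mul_le_mul_of_nonneg_left ht.2 hM0
  set A : Set (EuclideanSpace ℝ (Fin N) → ℝ) := {u | MemX0 s Ω u ∧ ∀ x, u x ∈ Set.Icc 0 b} with hA
  have hint : ∀ u ∈ A, |∫ x in Ω, ∫ τ in (0 : ℝ)..u x, g τ| ≤ M * b * volume.real Ω :=
    fun u hu => norm_setIntegral_le_of_norm_le_const (C := M * b)
      (f := fun x => ∫ τ in (0 : ℝ)..u x, g τ) hΩf.lt_top fun x _ => hGb _ (hu.2 x)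
  have hne : (energy s Ω g '' A).Nonempty :=
    ⟨_, _, ⟨memX0_zero, fun _ => ⟨le_rfl, hb⟩⟩, rfl⟩
  have hbdd : BddBelow (energy s Ω g '' A) := by
    refine ⟨-(M * b * volume.real Ω), ?_⟩
    rintro _ ⟨u, hu, rfl⟩
    have h1 := abs_le.1 (hint u hu)
    have h2 := gagliardoForm_self_nonneg (s := s) u
    rw [energy]
    linarith [h1.2]
  obtain ⟨e, hanti, hlim, hmem⟩ := exists_seq_tendsto_sInf hne hbdd
  choose u hu hue using hmem
  have hC : ∀ n, gagliardoForm s (u n) (u n) ≤ 2 * (e 0 + M * b * volume.real Ω) := fun n => by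
    have h1 := abs_le.1 (hint (u n) (hu n))
    have h2 := hanti (Nat.zero_le n)
    have h3 := hue n
    rw [energy] at h3
    linarith [h1.2]
  obtain ⟨φ, hφ, v₀, hv₀⟩ := exists_subseq_tendsto_ae hs0 hN hΩm hΩf (fun n => (hu n).1)
    (fun n x => by rw [abs_of_nonneg ((hu n).2 x).1]; exact ((hu n).2 x).2) hC
  -- The limit `v₀` is controlled only almost everywhere; clamping puts it in `[0, b]` at every
  -- point and keeps the convergence, since the sequence already takes values there.
  set v : EuclideanSpace ℝ (Fin N) → ℝ := fun x => max 0 (min (v₀ x) b) with hv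
  have hvI : ∀ x, v x ∈ Set.Icc 0 b := fun x => hclampI _
  have hconv : ∀ᵐ x, Tendsto (fun n => u (φ n) x) atTop (𝓝 (v x)) := by
    filter_upwards [hv₀] with x hx
    refine (((lipschitzWith_max_zero_min b).continuous.tendsto _).comp hx).congr fun n => ?_
    exact hclampF _ ((hu (φ n)).2 x)
  have hGlim : Tendsto (fun n => ∫ x in Ω, ∫ τ in (0 : ℝ)..u (φ n) x, g τ) atTop
      (𝓝 (∫ x in Ω, ∫ τ in (0 : ℝ)..v x, g τ)) := by
    refine tendsto_integral_of_dominated_convergence (fun _ => M * b)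
      (fun n => (integrableOn_primitive_comp hΩf hg hM (hu (φ n)).1).aestronglyMeasurable)
      (integrableOn_const hΩf) (fun n => Eventually.of_forall fun x => hGb _ ((hu (φ n)).2 x)) ?_
    filter_upwards [ae_restrict_of_ae hconv] with x hx
    exact ((continuous_primitive_of_continuous hg).tendsto _).comp hx
  -- Convergence of the energies and of the primitive terms forces the Gagliardo energies to
  -- converge, so Fatou bounds the energy of `v` by the infimum.
  have hform : Tendsto (fun n => gagliardoForm s (u (φ n)) (u (φ n))) atTop
      (𝓝 (2 * (sInf (energy s Ω g '' A) + ∫ x in Ω, ∫ τ in (0 : ℝ)..v x, g τ))) := by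
    refine (((hlim.comp hφ.tendsto_atTop).add hGlim).const_mul 2).congr fun n => ?_
    simp only [Function.comp_apply, ← hue, energy]
    ring
  obtain ⟨hvint, hvle⟩ := gagliardoForm_le_of_tendsto_ae (fun n => (hu (φ n)).1) hconv hform
  have hvout : ∀ᵐ x, x ∉ Ω → v x = 0 := by
    filter_upwards [hconv, ae_all_iff.2 fun n => (hu n).1.2] with x hx h hxΩ
    refine tendsto_nhds_unique hx ?_
    simp only [h _ hxΩ]
    exact tendsto_const_nhds
  have hvm : AEStronglyMeasurable v volume :=
    aestronglyMeasurable_of_tendsto_ae atTop (fun n => (hu (φ n)).1.memLp.1) hconv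
  have hvL2 : MemLp v 2 volume := by
    have h1 : MemLp (Ω.indicator fun _ => b) 2 (volume : Measure (EuclideanSpace ℝ (Fin N))) :=
      memLp_indicator_const 2 hΩm b (Or.inr hΩf)
    refine h1.mono hvm ?_
    filter_upwards [hvout] with x hx
    by_cases h : x ∈ Ω
    · rw [Set.indicator_of_mem h, Real.norm_of_nonneg (hvI x).1, Real.norm_of_nonneg hb]
      exact (hvI x).2
    · simp [hx h]
  have hvX : MemX0 s Ω v := ⟨⟨hvL2, hvint⟩, hvout⟩
  refine ⟨v, hvX, hvI, fun w hw => ?_⟩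
  have hw' := hw.comp_lipschitz (lipschitzWith_max_zero_min b) hclamp0
  have h1 : energy s Ω g v ≤ sInf (energy s Ω g '' A) := by rw [energy]; linarith
  have h2 : sInf (energy s Ω g '' A) ≤ energy s Ω g (fun x => max 0 (min (w x) b)) :=
    csInf_le hbdd ⟨_, ⟨hw', fun x => hclampI _⟩, rfl⟩
  -- This removes the constraint: clamping is a contraction, hence decreases the form, and by `hG`
  -- does not decrease the primitive.
  have h3 : energy s Ω g (fun x => max 0 (min (w x) b)) ≤ energy s Ω g w := by
    have h4 := gagliardoForm_comp_le hw (lipschitzWith_max_zero_min b) hclamp0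
    have h5 : ∫ x in Ω, ∫ τ in (0 : ℝ)..w x, g τ ≤
        ∫ x in Ω, ∫ τ in (0 : ℝ)..max 0 (min (w x) b), g τ :=
      integral_mono (integrableOn_primitive_comp hΩf hg hM hw)
        (integrableOn_primitive_comp hΩf hg hM hw') fun x => hG (w x)
    simp only [energy]
    linarith
  exact h1.trans (h2.trans h3)

/-- Euler-Lagrange equation for minimizers of the energy. -/
theorem gagliardoForm_eq_of_minimizer (hΩf : volume Ω ≠ ⊤) (hg : Continuous g)
    (hM : ∀ t, |g t| ≤ M) {v φ : EuclideanSpace ℝ (Fin N) → ℝ} (hv : MemX0 s Ω v)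
    (hmin : ∀ w, MemX0 s Ω w → energy s Ω g v ≤ energy s Ω g w) (hφ : MemX0 s Ω φ) :
    gagliardoForm s v φ = ∫ x in Ω, g (v x) * φ x := by
  have hder : HasDerivAt (fun c : ℝ => ∫ x in Ω, ∫ τ in (0 : ℝ)..v x + c * φ x, g τ)
      (∫ x in Ω, g (v x + 0 * φ x) * φ x) 0 := by
    refine (hasDerivAt_integral_of_dominated_loc_of_deriv_le (s := Set.univ)
      (F := fun (c : ℝ) x => ∫ τ in (0 : ℝ)..v x + c * φ x, g τ)
      (F' := fun (c : ℝ) x => g (v x + c * φ x) * φ x) (bound := fun x => M * |φ x|)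
      univ_mem (Eventually.of_forall fun c =>
        (integrableOn_primitive_comp hΩf hg hM (hv.add_const_mul hφ c)).aestronglyMeasurable)
      (integrableOn_primitive_comp hΩf hg hM (hv.add_const_mul hφ 0)) ?_
      (Eventually.of_forall fun x c _ => ?_) ((hφ.integrableOn hΩf).abs.const_mul M)
      (Eventually.of_forall fun x c _ => ?_)).2
    · exact ((hg.comp_aestronglyMeasurable (hv.add_const_mul hφ 0).memLp.1).mul hφ.memLp.1).restrict
    · rw [Real.norm_eq_abs, abs_mul]
      exact mul_le_mul_of_nonneg_right (hM _) (abs_nonneg _)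
    · have h1 : HasDerivAt (fun c : ℝ => v x + c * φ x) (φ x) c := by
        simpa using ((hasDerivAt_id c).mul_const (φ x)).const_add (v x)
      exact (hasDerivAt_primitive hg (v x + c * φ x)).comp c h1
  have hquad : HasDerivAt (fun c : ℝ => (gagliardoForm s v v + 2 * c * gagliardoForm s v φ +
      c ^ 2 * gagliardoForm s φ φ) / 2) (gagliardoForm s v φ) 0 := by
    have h1 := ((((hasDerivAt_id (0 : ℝ)).const_mul 2).mul_const (gagliardoForm s v φ)).const_add
      (gagliardoForm s v v)).add
      (((hasDerivAt_id (0 : ℝ)).pow 2).mul_const (gagliardoForm s φ φ))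
    refine (h1.div_const 2).congr_deriv ?_
    simp
  have hE : HasDerivAt (fun c : ℝ => energy s Ω g (fun x => v x + c * φ x))
      (gagliardoForm s v φ - ∫ x in Ω, g (v x + 0 * φ x) * φ x) 0 := by
    refine (hquad.sub hder).congr_of_eventuallyEq (Eventually.of_forall fun c => ?_)
    simp only [energy, Pi.sub_apply]
    rw [gagliardoForm_add_const_mul_self hv hφ c]
  -- Perturbations of either sign may leave `[0, b]`, hence the need for minimality over the whole
  -- space.
  have hloc : IsLocalMin (fun c : ℝ => energy s Ω g (fun x => v x + c * φ x)) 0 := by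
    refine Eventually.of_forall fun c => ?_
    have := hmin _ (hv.add_const_mul hφ c)
    simpa using this
  have h := hloc.hasDerivAt_eq_zero hE
  simp only [zero_mul, add_zero] at h
  linarith

end Minimization

/-! ### Strong maximum principle. -/

section MaximumPrinciple

variable {N : ℕ} {s : ℝ} {Ω : Set (EuclideanSpace ℝ (Fin N))} {g : ℝ → ℝ} {b : ℝ}

/-- Write `a = ψ - u / ε`, so `u = ε (ψ - a)`. With `Δ` for differences between two points, `(Δa⁺)²
≤ Δa Δa⁺`, and completing the square gives `Δu Δa⁺ ≤ ε (Δψ Δa⁺ - (Δa⁺)²) ≤ (ε / 4) (Δψ)²`. This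
one-sided bound is what permits Fatou as `ε → 0`. -/
theorem gagliardoIntegrand_max_sub_div_le (u ψ : EuclideanSpace ℝ (Fin N) → ℝ) {ε : ℝ}
    (hε : 0 < ε) (z : EuclideanSpace ℝ (Fin N) × EuclideanSpace ℝ (Fin N)) :
    gagliardoIntegrand s u (fun x => max (ψ x + -ε⁻¹ * u x) 0) z ≤
      ε / 4 * gagliardoIntegrand s ψ ψ z := by
  simp only [gagliardoIntegrand]
  rw [mul_div_assoc']
  refine div_le_div_of_nonneg_right ?_ (by positivity)
  obtain ⟨x, y⟩ := z
  simp only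
  obtain ⟨a, ha⟩ : ∃ a, a = ψ x + -ε⁻¹ * u x := ⟨_, rfl⟩
  obtain ⟨c, hc⟩ : ∃ c, c = ψ y + -ε⁻¹ * u y := ⟨_, rfl⟩
  have hu : u x = ε * (ψ x - a) := by rw [ha]; field_simp; ring
  have hv : u y = ε * (ψ y - c) := by rw [hc]; field_simp; ring
  rw [← ha, ← hc, hu, hv]
  have h1 : (max a 0 - max c 0) ^ 2 ≤ (a - c) * (max a 0 - max c 0) := by
    rcases le_total a 0 with h | h <;> rcases le_total c 0 with h' | h' <;>
      simp only [max_eq_left, max_eq_right, h, h'] <;> nlinarith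
  have h2 : (ψ x - ψ y) * (max a 0 - max c 0) - (max a 0 - max c 0) ^ 2 ≤ (ψ x - ψ y) ^ 2 / 4 := by
    nlinarith [sq_nonneg ((ψ x - ψ y) / 2 - (max a 0 - max c 0))]
  calc (ε * (ψ x - a) - ε * (ψ y - c)) * (max a 0 - max c 0)
      = ε * ((ψ x - ψ y) * (max a 0 - max c 0) - (a - c) * (max a 0 - max c 0)) := by ring
    _ ≤ ε * ((ψ x - ψ y) ^ 2 / 4) := by gcongr; linarith
    _ = ε / 4 * ((ψ x - ψ y) * (ψ x - ψ y)) := by ring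

/-- In the limit the test function `(ψ - u / ε)⁺` lives on the zero set of `u`. -/
theorem tendsto_max_sub_mul_inv {ε : ℕ → ℝ} (hε : ∀ n, 0 < ε n)
    (hε0 : Tendsto ε atTop (𝓝 0)) {p t : ℝ} (hp : 0 ≤ p) (ht : 0 ≤ t) :
    Tendsto (fun n => max (p + -(ε n)⁻¹ * t) 0) atTop (𝓝 (if t = 0 then p else 0)) := by
  split_ifs with h
  · simp [h, hp]
  · have ht0 : 0 < t := lt_of_le_of_ne ht (Ne.symm h)
    have hinv : Tendsto (fun n => (ε n)⁻¹ * t) atTop atTop :=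
      ((tendsto_inv_nhdsGT_zero.comp (tendsto_nhdsWithin_of_tendsto_nhds_of_eventually_within _
        hε0 (Eventually.of_forall hε))).atTop_mul_const ht0)
    refine tendsto_const_nhds.congr' ?_
    filter_upwards [hinv.eventually_ge_atTop p] with n hn
    rw [max_eq_right]
    linarith

/-- Strong maximum principle: a nonnegative bounded weak solution of `(-Δ)^s u = g(u)` with `g`
continuous and `g 0 = 0` is either zero or positive almost everywhere. -/
theorem ae_pos_of_weak_solution (hΩf : volume Ω ≠ ⊤) (hg : Continuous g) (hg0 : g 0 = 0)
    {u ψ : EuclideanSpace ℝ (Fin N) → ℝ} (hu : MemX0 s Ω u) (hub : ∀ x, u x ∈ Set.Icc 0 b)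
    (hweak : ∀ φ, MemX0 s Ω φ → gagliardoForm s u φ = ∫ x in Ω, g (u x) * φ x)
    (hψ : MemX0 s Ω ψ) (hψ01 : ∀ x, ψ x ∈ Set.Icc (0 : ℝ) 1) (hψpos : ∀ x ∈ Ω, 0 < ψ x)
    (hne : ¬ ∀ᵐ x, u x = 0) : ∀ᵐ x, x ∈ Ω → 0 < u x := by
  obtain ⟨M, hM⟩ := isCompact_Icc.exists_bound_of_continuousOn (s := Set.Icc 0 b) hg.continuousOn
  set ε : ℕ → ℝ := fun n => 1 / ((n : ℝ) + 1) with hεdef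
  have hε : ∀ n, 0 < ε n := fun n => Nat.one_div_pos_of_nat
  have hε0 : Tendsto ε atTop (𝓝 0) := tendsto_one_div_add_atTop_nhds_zero_nat
  set φ : ℕ → EuclideanSpace ℝ (Fin N) → ℝ := fun n x => max (ψ x + -(ε n)⁻¹ * u x) 0 with hφdef
  set χ : EuclideanSpace ℝ (Fin N) → ℝ := fun x => if u x = 0 then ψ x else 0 with hχ
  have hφ : ∀ n, MemX0 s Ω (φ n) := fun n =>
    (hψ.add_const_mul hu (-(ε n)⁻¹)).comp_lipschitz (LipschitzWith.id.max_const 0) (by simp)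
  have hφχ : ∀ x, Tendsto (fun n => φ n x) atTop (𝓝 (χ x)) := fun x =>
    tendsto_max_sub_mul_inv hε hε0 (hψ01 x).1 (hub x).1
  have hφb : ∀ n x, |φ n x| ≤ 1 := fun n x => by
    rw [abs_of_nonneg (le_max_right _ _)]
    refine max_le ?_ zero_le_one
    have h1 : 0 ≤ (ε n)⁻¹ * u x := mul_nonneg (inv_nonneg.2 (hε n).le) (hub x).1
    linarith [(hψ01 x).2]
  -- The limit `χ` is supported where `u = 0`, and there `g (u x) = g 0 = 0`.
  have hRHS : Tendsto (fun n => ∫ x in Ω, g (u x) * φ n x) atTop (𝓝 0) := by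
    have h0 : (0 : ℝ) = ∫ x in Ω, (0 : ℝ) := by simp
    rw [h0]
    refine tendsto_integral_of_dominated_convergence (fun _ => M)
      (fun n => ((hg.comp_aestronglyMeasurable hu.memLp.1).mul (hφ n).memLp.1).restrict)
      (integrableOn_const hΩf) (fun n => Eventually.of_forall fun x => ?_)
      (Eventually.of_forall fun x => ?_)
    · rw [norm_mul]
      exact (mul_le_of_le_one_right (norm_nonneg _) (hφb n x)).trans (hM _ (hub x))
    · have h1 := (hφχ x).const_mul (g (u x))
      have h2 : g (u x) * χ x = 0 := by
        simp only [hχ]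
        split_ifs with h
        · rw [h, hg0, zero_mul]
        · rw [mul_zero]
      rwa [h2] at h1
  have hnonneg : ∀ z, 0 ≤ -gagliardoIntegrand s u χ z := by
    rintro ⟨x, y⟩
    simp only [gagliardoIntegrand, hχ]
    rw [← neg_div]
    refine div_nonneg ?_ (by positivity)
    have hx := (hub x).1
    have hy := (hub y).1
    have hpx := (hψ01 x).1
    have hpy := (hψ01 y).1
    split_ifs with h1 h2 h2
    · simp [h1, h2]
    · rw [h1]; nlinarith [mul_nonneg hy hpx]
    · rw [h2]; nlinarith [mul_nonneg hx hpy]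
    · simp
  have hlim : Tendsto (fun n => ε n / 4 * gagliardoForm s ψ ψ - ∫ x in Ω, g (u x) * φ n x) atTop
      (𝓝 0) := by
    simpa using ((hε0.div_const 4).mul_const (gagliardoForm s ψ ψ)).sub hRHS
  -- Fatou shows that the nonnegative function `-gagliardoIntegrand s u χ` has integral at most `0`,
  -- hence vanishes almost everywhere.
  obtain ⟨hint, hle⟩ := integrable_and_integral_le_of_tendsto_ae
    (F := fun n z => ε n / 4 * gagliardoIntegrand s ψ ψ z - gagliardoIntegrand s u (φ n) z)
    (G := fun z => -gagliardoIntegrand s u χ z) (μ := volume)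
    (fun n => (hψ.1.2.const_mul _).sub (hu.integrable_gagliardoIntegrand (hφ n)))
    (fun n => Eventually.of_forall fun z =>
      sub_nonneg.2 (gagliardoIntegrand_max_sub_div_le u ψ (hε n) z))
    (by
      filter_upwards [tendsto_gagliardoIntegrand (s := s) (u := fun _ => u) (u₀ := u) (v := φ)
        (v₀ := χ) (Eventually.of_forall fun x => tendsto_const_nhds)
        (Eventually.of_forall hφχ)] with z hz
      simpa using ((hε0.div_const 4).mul_const (gagliardoIntegrand s ψ ψ z)).sub hz)
    (fun n => by
      rw [integral_sub (hψ.1.2.const_mul _) (hu.integrable_gagliardoIntegrand (hφ n)),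
        integral_const_mul, ← hweak _ (hφ n)]
      exact le_rfl) hlim
  have hzero : ∀ᵐ z, gagliardoIntegrand s u χ z = 0 := by
    have h1 := (integral_eq_zero_iff_of_nonneg hnonneg hint).1
      (le_antisymm hle (integral_nonneg hnonneg))
    filter_upwards [h1] with z hz
    simpa using hz
  -- If `u` vanished on a nonnull part of `Ω`, some `x ∈ Ω` with `u x = 0` would be good for almost
  -- every `y`. Where `u y ≠ 0` the numerator is `-u y * ψ x`, with `ψ x > 0`; so `u = 0` almost
  -- everywhere.
  have hae := Measure.ae_ae_of_ae_prod hzero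
  by_contra hcon
  have hfreq : ∃ᶠ x in ae volume, ¬ (x ∈ Ω → 0 < u x) := not_eventually.1 hcon
  obtain ⟨x, hx, hxae⟩ := (hfreq.and_eventually hae).exists
  obtain ⟨hxΩ, hux⟩ := Classical.not_imp.1 hx
  have hux0 : u x = 0 := le_antisymm (not_lt.1 hux) (hub x).1
  refine hne ?_
  filter_upwards [hxae] with y hy
  by_contra huy
  have hxy : x ≠ y := fun h => huy (h ▸ hux0)
  have hnorm : 0 < ‖x - y‖ := norm_pos_iff.2 (sub_ne_zero.2 hxy)
  have hpow : ‖x - y‖ ^ ((N : ℝ) + 2 * s) ≠ 0 := (Real.rpow_pos_of_pos hnorm _).ne'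
  simp only [gagliardoIntegrand, hχ, hux0, huy, if_true, if_false, div_eq_zero_iff, hpow, or_false,
    zero_sub, sub_zero, mul_eq_zero, neg_eq_zero, false_or] at hy
  exact (hψpos x hxΩ).ne' hy

end MaximumPrinciple

/-! ### Small positive solutions by truncation. -/

section Existence

variable {N : ℕ} {s : ℝ} {Ω : Set (EuclideanSpace ℝ (Fin N))} {g : ℝ → ℝ}

/-- The energy takes negative values if `∫₀ᵗ g` is large compared with `t²` at arbitrarily small
`t > 0` and bounded below by a multiple of `t²`. -/
theorem exists_energy_neg (hΩf : volume Ω ≠ ⊤) {M : ℝ} (hg : Continuous g) (hM : ∀ t, |g t| ≤ M)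
    {C : ℝ} (hlow : ∀ᶠ t in 𝓝[>] (0 : ℝ), C * t ^ 2 ≤ ∫ τ in (0 : ℝ)..t, g τ)
    (hup : ∀ K : ℝ, ∃ᶠ t in 𝓝[>] (0 : ℝ), K * t ^ 2 < ∫ τ in (0 : ℝ)..t, g τ)
    {ψ : EuclideanSpace ℝ (Fin N) → ℝ} (hψ : MemX0 s Ω ψ) (hψ01 : ∀ x, ψ x ∈ Set.Icc (0 : ℝ) 1)
    {B : Set (EuclideanSpace ℝ (Fin N))} (hBΩ : B ⊆ Ω) (hBm : MeasurableSet B)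
    (hB0 : 0 < volume B) (hψB : ∀ x ∈ B, ψ x = 1) :
    ∃ w, MemX0 s Ω w ∧ energy s Ω g w < 0 := by
  have hB : 0 < volume.real B :=
    ENNReal.toReal_pos hB0.ne' (measure_ne_top_of_subset hBΩ hΩf)
  obtain ⟨δ, hδ0, hδ⟩ := mem_nhdsGT_iff_exists_Ioo_subset.1 hlow
  have hδ0' : (0 : ℝ) < δ := hδ0
  -- The constant is chosen so that `|B|` times the primitive at `t` exceeds the sum of the
  -- Gagliardo term `t² / 2 * gagliardoForm s ψ ψ` and the possible loss `|C| t² |Ω|` where `ψ < 1`.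
  obtain ⟨t, htK, ht0, htδ⟩ := ((hup ((gagliardoForm s ψ ψ / 2 + |C| * volume.real Ω) /
    volume.real B)).and_eventually (Ioo_mem_nhdsGT hδ0')).exists
  refine ⟨fun x => t * ψ x, hψ.const_mul t, ?_⟩
  have hpt : ∀ x, B.indicator (fun _ => ∫ τ in (0 : ℝ)..t, g τ) x - |C| * t ^ 2 ≤
      ∫ τ in (0 : ℝ)..t * ψ x, g τ := by
    intro x
    by_cases hx : x ∈ B
    · rw [Set.indicator_of_mem hx, hψB x hx, mul_one]
      have : 0 ≤ |C| * t ^ 2 := by positivity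
      linarith
    · rw [Set.indicator_of_notMem hx]
      obtain ⟨h0, h1⟩ := hψ01 x
      rcases h0.eq_or_lt with h | h
      · rw [← h, mul_zero, intervalIntegral.integral_same]
        have : 0 ≤ |C| * t ^ 2 := by positivity
        linarith
      · have h2 : t * ψ x ≤ t := mul_le_of_le_one_right ht0.le h1
        have h3 : C * (t * ψ x) ^ 2 ≤ ∫ τ in (0 : ℝ)..t * ψ x, g τ :=
          hδ ⟨mul_pos ht0 h, h2.trans_lt htδ⟩
        have h4 : |C| * (t * ψ x) ^ 2 ≤ |C| * t ^ 2 := by gcongr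
        have h5 : -(|C| * (t * ψ x) ^ 2) ≤ C * (t * ψ x) ^ 2 := by
          rw [← neg_mul]; exact mul_le_mul_of_nonneg_right (neg_abs_le C) (sq_nonneg _)
        linarith
  have hind : IntegrableOn (B.indicator fun _ => ∫ τ in (0 : ℝ)..t, g τ) Ω volume :=
    (integrableOn_const hΩf).indicator hBm
  have hint := integral_mono (μ := volume.restrict Ω) (hind.sub (integrableOn_const hΩf))
    (integrableOn_primitive_comp hΩf hg hM (hψ.const_mul t)) hpt
  simp only [Pi.sub_apply] at hint
  rw [integral_sub hind (integrableOn_const hΩf), setIntegral_indicator hBm,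
    Set.inter_eq_self_of_subset_right hBΩ, setIntegral_const, setIntegral_const, smul_eq_mul,
    smul_eq_mul] at hint
  rw [energy, gagliardoForm_const_mul_self]
  rw [div_mul_eq_mul_div, div_lt_iff₀ hB] at htK
  nlinarith

/-- Small positive solutions of `(-Δ)^s u = g(u)` for nonlinearities which are negative at
arbitrarily small arguments and whose primitive oscillates. -/
theorem exists_small_positive_solution (hs0 : 0 < s) (hs1 : s < 1) (hN : 0 < N) (hΩo : IsOpen Ω)
    (hΩn : Ω.Nonempty) (hΩb : Bornology.IsBounded Ω) (hg : ContinuousOn g (Set.Ici 0))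
    (hg0 : g 0 = 0) (hneg : ∃ᶠ t in 𝓝[>] (0 : ℝ), g t < 0)
    {C : ℝ} (hlow : ∀ᶠ t in 𝓝[>] (0 : ℝ), C * t ^ 2 ≤ ∫ τ in (0 : ℝ)..t, g τ)
    (hup : ∀ K : ℝ, ∃ᶠ t in 𝓝[>] (0 : ℝ), K * t ^ 2 < ∫ τ in (0 : ℝ)..t, g τ)
    {δ : ℝ} (hδ : 0 < δ) :
    ∃ u : EuclideanSpace ℝ (Fin N) → ℝ, MemX0 s Ω u ∧ (∀ x, u x ∈ Set.Icc 0 δ) ∧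
      (∀ φ, MemX0 s Ω φ → gagliardoForm s u φ = ∫ x in Ω, g (u x) * φ x) ∧
      ∀ᵐ x, x ∈ Ω → 0 < u x := by
  have hΩf : volume Ω ≠ ⊤ := hΩb.measure_lt_top.ne
  have hΩm := hΩo.measurableSet
  -- The sign `g b < 0` is what makes `b` an upper barrier.
  obtain ⟨b, hgb, hb0, hbδ⟩ := (hneg.and_eventually (Ioo_mem_nhdsGT hδ)).exists
  set h : ℝ → ℝ := fun t => g (max 0 (min t b)) with hh
  have hclampI : ∀ t, max 0 (min t b) ∈ Set.Icc 0 b := fun t =>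
    ⟨le_max_left _ _, max_le hb0.le (min_le_right _ _)⟩
  have hhc : Continuous h := hg.comp_continuous (lipschitzWith_max_zero_min b).continuous
    fun t => (hclampI t).1
  have hheq : ∀ t ∈ Set.Icc 0 b, h t = g t := fun t ht => by
    simp only [hh]; rw [min_eq_left ht.2, max_eq_right ht.1]
  obtain ⟨M, hM⟩ := isCompact_Icc.exists_bound_of_continuousOn (s := Set.Icc 0 b)
    (hg.mono Set.Icc_subset_Ici_self)
  have hhM : ∀ t, |h t| ≤ M := fun t => hM _ (hclampI t)
  have hprim : ∀ t ∈ Set.Icc 0 b, ∫ τ in (0 : ℝ)..t, h τ = ∫ τ in (0 : ℝ)..t, g τ := by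
    intro t ht
    refine intervalIntegral.integral_congr fun τ hτ => ?_
    rw [Set.uIcc_of_le ht.1] at hτ
    exact hheq τ ⟨hτ.1, hτ.2.trans ht.2⟩
  have hnear : ∀ᶠ t in 𝓝[>] (0 : ℝ), ∫ τ in (0 : ℝ)..t, h τ = ∫ τ in (0 : ℝ)..t, g τ := by
    filter_upwards [Ioo_mem_nhdsGT hb0] with t ht
    exact hprim t ⟨ht.1.le, ht.2.le⟩
  -- The difference of the two sides is an integral of `h` over the part cut off: there `h` is `0`
  -- on the left and `g b < 0` on the right.
  have hG : ∀ t, ∫ τ in (0 : ℝ)..t, h τ ≤ ∫ τ in (0 : ℝ)..max 0 (min t b), h τ := by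
    intro t
    rw [← sub_nonpos, intervalIntegral.integral_interval_sub_left (hhc.intervalIntegrable _ _)
      (hhc.intervalIntegrable _ _)]
    rcases le_total t 0 with ht | ht
    · rw [min_eq_left (ht.trans hb0.le), max_eq_left ht, intervalIntegral.integral_symm,
        intervalIntegral.integral_congr (g := fun _ => 0)]
      · simp
      · intro τ hτ
        rw [Set.uIcc_of_le ht] at hτ
        simp only [hh]
        rw [min_eq_left (hτ.2.trans hb0.le), max_eq_left hτ.2, hg0]
    · rcases le_total t b with htb | htb
      · rw [min_eq_left htb, max_eq_right ht, intervalIntegral.integral_same]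
      · rw [min_eq_right htb, max_eq_right hb0.le,
          intervalIntegral.integral_congr (g := fun _ => g b)]
        · rw [intervalIntegral.integral_const, smul_eq_mul]
          exact mul_nonpos_of_nonneg_of_nonpos (sub_nonneg.2 htb) hgb.le
        · intro τ hτ
          rw [Set.uIcc_of_le htb] at hτ
          simp only [hh]
          rw [min_eq_right hτ.1, max_eq_right hb0.le]
  obtain ⟨v, hv, hvI, hmin⟩ := exists_energy_minimizer hs0 hN hΩm hΩf hb0.le hhc hhM hG
  obtain ⟨ψ, hψ, hψ01, hψpos, B, hBΩ, hBm, hB0, hψB⟩ :=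
    exists_cutoff hs0 hs1 hN hΩo hΩn hΩb
  obtain ⟨w, hw, hwneg⟩ := exists_energy_neg hΩf hhc hhM (C := C)
    (by filter_upwards [hlow, hnear] with t h1 h2; rwa [h2])
    (fun K => ((hup K).and_eventually hnear).mono fun t ht => by rw [ht.2]; exact ht.1)
    hψ hψ01 hBΩ hBm hB0 hψB
  -- The zero function has energy `0`, while the minimum is negative.
  have hne : ¬ ∀ᵐ x, v x = 0 := by
    intro h0
    have h1 : energy s Ω h v = 0 := by
      rw [energy, gagliardoForm_congr_ae (u' := fun _ => 0) (v' := fun _ => 0) h0 h0,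
        integral_congr_ae (g := fun _ => 0)]
      · simp [gagliardoForm, gagliardoIntegrand]
      · filter_upwards [ae_restrict_of_ae h0] with x hx
        rw [hx, intervalIntegral.integral_same]
    linarith [hmin w hw]
  have hEL : ∀ φ, MemX0 s Ω φ → gagliardoForm s v φ = ∫ x in Ω, h (v x) * φ x := fun φ hφ =>
    gagliardoForm_eq_of_minimizer hΩf hhc hhM hv hmin hφ
  refine ⟨v, hv, fun x => ⟨(hvI x).1, (hvI x).2.trans hbδ.le⟩,
    fun φ hφ => ?_, ?_⟩
  · rw [hEL φ hφ]
    exact integral_congr_ae (Eventually.of_forall fun x => by simp only [hheq _ (hvI x)])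
  · exact ae_pos_of_weak_solution hΩf hhc (by rw [hheq 0 ⟨le_rfl, hb0.le⟩, hg0]) hv hvI hEL
      hψ hψ01 hψpos hne

end Existence

/-! ### Oscillation of `f` passes to `lam * t ^ p + f t`. -/

section Nonlinearity

variable {f : ℝ → ℝ} {p lam : ℝ}

theorem continuousOn_mul_rpow_add (hf : ContinuousOn f (Set.Ici 0)) (hp : 1 ≤ p) :
    ContinuousOn (fun t => lam * t ^ p + f t) (Set.Ici 0) :=
  ((Real.continuous_rpow_const (by linarith)).const_mul lam).continuousOn.add hf

/-- For `0 < τ ≤ t < 1` and `p ≥ 1` one has `τ ^ p ≤ τ ≤ t`. The power term thus shifts the quotient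
primitive over `t²` by a bounded amount, preserving both its lower bound and its unboundedness
above, whatever `lam` is. -/
theorem abs_primitive_mul_rpow_add_sub_le (hf : ContinuousOn f (Set.Ici 0)) (hp : 1 ≤ p) {t : ℝ}
    (ht : t ∈ Set.Ioo (0 : ℝ) 1) :
    |(∫ τ in (0 : ℝ)..t, (lam * τ ^ p + f τ)) - ∫ τ in (0 : ℝ)..t, f τ| ≤ |lam| * t ^ 2 := by
  have hfi : IntervalIntegrable f volume 0 t :=
    (hf.mono (by rw [Set.uIcc_of_le ht.1.le]; exact Set.Icc_subset_Ici_self)).intervalIntegrable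
  have hpi : IntervalIntegrable (fun τ : ℝ => lam * τ ^ p) volume 0 t :=
    ((Real.continuous_rpow_const (by linarith)).const_mul lam).intervalIntegrable _ _
  rw [intervalIntegral.integral_add hpi hfi, add_sub_cancel_right]
  have h := intervalIntegral.norm_integral_le_of_norm_le_const (a := 0) (b := t)
    (f := fun τ : ℝ => lam * τ ^ p) (C := |lam| * t) fun τ hτ => by
      rw [Set.uIoc_of_le ht.1.le] at hτ
      rw [norm_mul, Real.norm_eq_abs, Real.norm_of_nonneg (Real.rpow_nonneg hτ.1.le p)]
      refine mul_le_mul_of_nonneg_left (le_trans ?_ hτ.2) (abs_nonneg _)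
      exact (Real.rpow_le_rpow_of_exponent_ge hτ.1 (hτ.2.trans ht.2.le) hp).trans_eq
        (Real.rpow_one τ)
  rw [sub_zero, abs_of_pos ht.1, Real.norm_eq_abs] at h
  linarith

theorem OscillatesNearZero.exists_eventually_le (hosc : OscillatesNearZero f)
    (hf : ContinuousOn f (Set.Ici 0)) (hp : 1 ≤ p) (lam : ℝ) :
    ∃ C : ℝ, ∀ᶠ t in 𝓝[>] (0 : ℝ), C * t ^ 2 ≤ ∫ τ in (0 : ℝ)..t, (lam * τ ^ p + f τ) := by
  obtain ⟨C, -, hC⟩ := EReal.lt_iff_exists_real_btwn.1 hosc.liminf_gt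
  refine ⟨C - |lam|, ?_⟩
  filter_upwards [eventually_lt_of_lt_liminf hC, Ioo_mem_nhdsGT one_pos] with t ht h01
  have h1 := abs_le.1 (abs_primitive_mul_rpow_add_sub_le (lam := lam) hf hp h01)
  rw [primitiveQuotient, EReal.coe_lt_coe_iff, lt_div_iff₀ (pow_pos h01.1 2)] at ht
  linarith [h1.1]

theorem OscillatesNearZero.frequently_lt (hosc : OscillatesNearZero f)
    (hf : ContinuousOn f (Set.Ici 0)) (hp : 1 ≤ p) (lam K : ℝ) :
    ∃ᶠ t in 𝓝[>] (0 : ℝ), K * t ^ 2 < ∫ τ in (0 : ℝ)..t, (lam * τ ^ p + f τ) := by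
  have h : ((K + |lam| : ℝ) : EReal) < limsup (primitiveQuotient f) (𝓝[>] 0) := by
    rw [hosc.limsup_eq]; exact EReal.coe_lt_top _
  refine ((frequently_lt_of_lt_limsup (by isBoundedDefault) h).and_eventually
    (Ioo_mem_nhdsGT one_pos)).mono ?_
  rintro t ⟨ht, h01⟩
  have h1 := abs_le.1 (abs_primitive_mul_rpow_add_sub_le (lam := lam) hf hp h01)
  rw [primitiveQuotient, EReal.coe_lt_coe_iff, lt_div_iff₀ (pow_pos h01.1 2)] at ht
  linarith [h1.1]

/-- For `p = 1`, `f t / t < -lam₀ < -lam` at arbitrarily small `t`. For `p > 1`, `f t / t` lies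
frequently below a fixed negative `c`, whereas `lam * t ^ (p - 1)` tends to `0`. -/
theorem frequently_mul_rpow_add_neg (hlz : lZero f < 0)
    (hp : (p = 1 ∧ ∃ lam₀ : ℝ, 0 < lam₀ ∧ (lam₀ : EReal) < -lZero f ∧ lam < lam₀) ∨ 1 < p) :
    ∃ᶠ t in 𝓝[>] (0 : ℝ), lam * t ^ p + f t < 0 := by
  rcases hp with ⟨rfl, lam₀, -, hlam₀, hlam⟩ | hp
  · have h : lZero f < ((-lam₀ : ℝ) : EReal) := by
      rw [EReal.coe_neg]; exact EReal.lt_neg_comm.1 hlam₀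
    refine ((frequently_lt_of_liminf_lt (by isBoundedDefault) h).and_eventually
      self_mem_nhdsWithin).mono ?_
    rintro t ⟨ht, ht0⟩
    have ht0' : (0 : ℝ) < t := ht0
    rw [EReal.coe_lt_coe_iff, div_lt_iff₀ ht0'] at ht
    rw [Real.rpow_one]
    have := mul_lt_mul_of_pos_right hlam ht0'
    linarith
  · obtain ⟨c, hc, hc0⟩ := EReal.lt_iff_exists_real_btwn.1 hlz
    have hc0' : c < 0 := by exact_mod_cast hc0
    have hlim : Tendsto (fun t : ℝ => lam * t ^ (p - 1)) (𝓝[>] 0) (𝓝 0) := by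
      have h1 := ((Real.continuous_rpow_const (q := p - 1) (by linarith)).const_mul lam).tendsto 0
      rw [Real.zero_rpow (by linarith), mul_zero] at h1
      exact tendsto_nhdsWithin_of_tendsto_nhds h1
    refine ((frequently_lt_of_liminf_lt (by isBoundedDefault) hc).and_eventually
      ((hlim.eventually_lt_const (neg_pos.2 hc0')).and self_mem_nhdsWithin)).mono ?_
    rintro t ⟨ht, hlt, ht0⟩
    have ht0' : (0 : ℝ) < t := ht0
    rw [EReal.coe_lt_coe_iff, div_lt_iff₀ ht0'] at ht
    have h2 : t ^ p = t ^ (p - 1) * t := by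
      rw [← Real.rpow_add_one ht0'.ne', sub_add_cancel]
    rw [h2, ← mul_assoc]
    have := mul_lt_mul_of_pos_right hlt ht0'
    linarith

end Nonlinearity

/-! ### Integrability of the right-hand side. -/

section Solutions

variable {N : ℕ} {s : ℝ} {Ω : Set (EuclideanSpace ℝ (Fin N))}

theorem integrableOn_comp_mul {g : ℝ → ℝ} {b : ℝ} (hΩf : volume Ω ≠ ⊤)
    (hg : ContinuousOn g (Set.Ici 0)) {u φ : EuclideanSpace ℝ (Fin N) → ℝ} (hu : MemX0 s Ω u)
    (hub : ∀ x, u x ∈ Set.Icc 0 b) (hφ : MemX0 s Ω φ) :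
    IntegrableOn (fun x => g (u x) * φ x) Ω := by
  obtain ⟨M, hM⟩ := isCompact_Icc.exists_bound_of_continuousOn (s := Set.Icc 0 b)
    (hg.mono Set.Icc_subset_Ici_self)
  -- As `g` is continuous only on `[0, ∞)`, measurability goes through this continuous extension,
  -- which agrees with `g` on the values of `u`.
  have hext : Continuous fun t => g (max 0 t) :=
    hg.comp_continuous (by fun_prop) fun t => Set.mem_Ici.2 (le_max_left _ _)
  refine Integrable.bdd_mul (c := M) (hφ.integrableOn hΩf) ?_
    (Eventually.of_forall fun x => hM _ (hub x))
  refine ((hext.comp_aestronglyMeasurable hu.memLp.1).congr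
    (Eventually.of_forall fun x => ?_)).restrict
  simp only [max_eq_right (hub x).1]

end Solutions

end

/-! ### Construction of the sequence of solutions. -/

theorem theorem1p1 {N : ℕ} (s : ℝ) (hs0 : 0 < s) (hs1 : s < 1) (hN : 2 * s < (N : ℝ))
    (Ω : Set (EuclideanSpace ℝ (Fin N))) (hΩ : IsBoundedSmoothDomain Ω)
    (f : ℝ → ℝ) (hf : ContinuousOn f (Set.Ici 0)) (hf0 : f 0 = 0) (hosc : OscillatesNearZero f)
    (p lam : ℝ)
    (hp : (p = 1 ∧ ∃ lam₀ : ℝ, 0 < lam₀ ∧ (lam₀ : EReal) < -lZero f ∧ lam < lam₀) ∨ 1 < p) :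
    ∃ u : ℕ → EuclideanSpace ℝ (Fin N) → ℝ,
      (∀ k, IsPositiveWeakSolution s Ω lam p f (u k)) ∧
      (∀ k, MemLp (u k) ⊤ (volume.restrict Ω)) ∧
      (∀ j k, j ≠ k → ¬ u j =ᵐ[volume] u k) ∧
      Tendsto (fun k => normX0 s (u k)) atTop (𝓝 0) ∧
      Tendsto (fun k => eLpNorm (u k) ⊤ (volume.restrict Ω)) atTop (𝓝 0) := by
  have hN0 : 0 < N := by
    have : (0 : ℝ) < N := by linarith
    exact_mod_cast this
  have hp1 : 1 ≤ p := by rcases hp with h | h <;> linarith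
  have hΩn : Ω.Nonempty := hΩ.isConnected.nonempty
  have hΩf : volume Ω ≠ ⊤ := hΩ.isBounded.measure_lt_top.ne
  have hΩm : MeasurableSet Ω := hΩ.isOpen.measurableSet
  have hΩ0 : volume.restrict Ω ≠ 0 := by
    rw [Ne, Measure.restrict_eq_zero]
    exact (hΩ.isOpen.measure_pos volume hΩn).ne'
  set g : ℝ → ℝ := fun t => lam * t ^ p + f t with hgdef
  have hg : ContinuousOn g (Set.Ici 0) := continuousOn_mul_rpow_add hf hp1
  have hg0 : g 0 = 0 := by
    simp only [hgdef]
    rw [Real.zero_rpow (by linarith), hf0]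
    ring
  obtain ⟨C, hlow⟩ := hosc.exists_eventually_le hf hp1 lam
  choose U hUmem hUb hUeq hUpos using fun δ : {δ : ℝ // 0 < δ} =>
    exists_small_positive_solution hs0 hs1 hN0 hΩ.isOpen hΩn hΩ.isBounded hg hg0
      (frequently_mul_rpow_add_neg hosc.lZero_neg hp) hlow (hosc.frequently_lt hf hp1 lam) δ.2
  have hle : ∀ δ, eLpNorm (U δ) ⊤ (volume.restrict Ω) ≤ ENNReal.ofReal δ.1 := fun δ => by
    rw [eLpNorm_exponent_top]
    refine eLpNormEssSup_le_of_ae_bound (Eventually.of_forall fun x => ?_)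
    rw [Real.norm_of_nonneg (hUb δ x).1]
    exact (hUb δ x).2
  have hpos : ∀ δ, 0 < (eLpNorm (U δ) ⊤ (volume.restrict Ω)).toReal := fun δ => by
    refine ENNReal.toReal_pos (fun h0 => hΩ0 ?_) ((hle δ).trans_lt ENNReal.ofReal_lt_top).ne
    rw [eLpNorm_eq_zero_iff (hUmem δ).memLp.1.restrict ENNReal.top_ne_zero] at h0
    rw [← ae_eq_bot, ← eventually_false_iff_eq_bot]
    filter_upwards [h0, ae_restrict_of_ae (hUpos δ), ae_restrict_mem hΩm] with x h1 h2 h3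
    exact (h2 h3).ne' h1
  -- The next bound is half the sup norm of the current solution. The sup norms then strictly
  -- decrease, which separates the solutions, and the bounds decay at least like `(1 / 2) ^ k`.
  set d : ℕ → {δ : ℝ // 0 < δ} := fun k => Nat.rec ⟨1, one_pos⟩
    (fun _ δ => ⟨(eLpNorm (U δ) ⊤ (volume.restrict Ω)).toReal / 2, half_pos (hpos δ)⟩) k with hd
  have hdsucc : ∀ k, (d (k + 1)).1 = (eLpNorm (U (d k)) ⊤ (volume.restrict Ω)).toReal / 2 :=
    fun k => rfl
  have hnle : ∀ k, (eLpNorm (U (d k)) ⊤ (volume.restrict Ω)).toReal ≤ (d k).1 := fun k =>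
    ENNReal.toReal_le_of_le_ofReal (d k).2.le (hle _)
  have hdpow : ∀ k, (d k).1 ≤ (1 / 2) ^ k := fun k => by
    induction k with
    | zero => simp [hd]
    | succ k ih =>
      rw [hdsucc, pow_succ]
      linarith [hnle k]
  have hd0 : Tendsto (fun k => (d k).1) atTop (𝓝 0) :=
    squeeze_zero (fun k => (d k).2.le) hdpow
      (tendsto_pow_atTop_nhds_zero_of_lt_one (by norm_num) (by norm_num))
  have hanti : StrictAnti fun k => (eLpNorm (U (d k)) ⊤ (volume.restrict Ω)).toReal := by
    refine strictAnti_nat_of_succ_lt fun k => (hnle (k + 1)).trans_lt ?_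
    rw [hdsucc]
    exact half_lt_self (hpos _)
  refine ⟨fun k => U (d k), fun k => ⟨hUmem _, hUpos _, fun φ hφ => ?_, fun φ hφ => ?_,
    fun φ hφ => ?_⟩, fun k => ?_, fun j k hjk h => ?_, ?_, ?_⟩
  · exact integrableOn_comp_mul hΩf (Real.continuous_rpow_const (by linarith)).continuousOn
      (hUmem _) (hUb _) hφ
  · exact integrableOn_comp_mul hΩf hf (hUmem _) (hUb _) hφ
  · have h1 := integrableOn_comp_mul hΩf
      (Real.continuous_rpow_const (q := p) (by linarith)).continuousOn (hUmem (d k)) (hUb _) hφ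
    have h2 := integrableOn_comp_mul hΩf hf (hUmem (d k)) (hUb _) hφ
    rw [hUeq _ φ hφ, ← integral_const_mul, ← integral_add (h1.const_mul lam) h2]
    refine integral_congr_ae (Eventually.of_forall fun x => ?_)
    simp only [hgdef]
    ring
  · exact ⟨(hUmem _).memLp.1.restrict, (hle _).trans_lt ENNReal.ofReal_lt_top⟩
  · refine hjk (hanti.injective ?_)
    exact congrArg ENNReal.toReal (eLpNorm_congr_ae (ae_restrict_of_ae h))
  · obtain ⟨M, hM⟩ := isCompact_Icc.exists_bound_of_continuousOn (s := Set.Icc (0 : ℝ) 1)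
      (hg.mono Set.Icc_subset_Ici_self)
    -- Testing the equation with the solution itself gives energy at most `M * d k * |Ω|`; a single
    -- `M` works since all solutions take values in `[0, 1]`.
    have hform : Tendsto (fun k => gagliardoForm s (U (d k)) (U (d k))) atTop (𝓝 0) := by
      have hlim : Tendsto (fun k => M * (d k).1 * volume.real Ω) atTop (𝓝 0) := by
        simpa using (hd0.const_mul M).mul_const (volume.real Ω)
      refine squeeze_zero (fun k => gagliardoForm_self_nonneg _) (fun k => ?_) hlim
      rw [hUeq _ _ (hUmem _)]
      refine (le_abs_self _).trans ?_
      refine norm_setIntegral_le_of_norm_le_const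
        (f := fun x => g (U (d k) x) * U (d k) x) hΩf.lt_top fun x _ => ?_
      have hb := hUb (d k) x
      have h1 : (d k).1 ≤ 1 := (hdpow k).trans (pow_le_one₀ (by norm_num) (by norm_num))
      have h2 := hM _ ⟨hb.1, hb.2.trans h1⟩
      rw [norm_mul, Real.norm_of_nonneg hb.1]
      exact mul_le_mul h2 hb.2 hb.1 ((norm_nonneg _).trans h2)
    have := (Real.continuous_sqrt.tendsto 0).comp hform
    rwa [Real.sqrt_zero] at this
  · have h0 : Tendsto (fun k => ENNReal.ofReal (d k).1) atTop (𝓝 0) := by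
      have := (ENNReal.continuous_ofReal.tendsto 0).comp hd0
      rwa [ENNReal.ofReal_zero] at this
    exact tendsto_of_tendsto_of_tendsto_of_le_of_le tendsto_const_nhds h0 (fun _ => bot_le)
      fun k => hle _
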